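/- Let $(Q_r)_{r\ge 1}$ be positive real numbers such that the limit $\phi_c:=\lim_{r\to\infty}Q_r^{-1/r}$ exists and $\phi_c\in(1,\infty]$; then $w:=\sum_{r\ge1}Q_r<\infty$. For $j\ge 1$ and $z\in[0,\infty]$ put $F_j(z):=\sum_{r\ge j}rQ_rz^r\in[0,\infty]$ and $\rho_{c,j}:=F_j(\phi_c)$, and for $x\ge 0$ let $\varphi_j(x)\in[0,\infty)$ be the unique $z\in[0,\phi_c]$ with $F_j(z)=\min(x,\rho_{c,j})$. Write $\varphi:=\varphi_1$. Let $V_n>0$ with $V_n\to\infty$ and $M_n\in\mathbb N$ with $M_n/V_n\to\rho\in(0,\infty)$. Let $Y_1,Y_2,\dots$ be i.i.d. with $\mathbb P(Y_i=r)=Q_r/w$ for $r\ge1$, and for each $n$ let $N_n$ be a Poisson random variable with parameter $wV_n$, independent of $(Y_i)_i$. Put $$\mathcal L_r^{(n)}:=\#\{1\le i\le N_n:\ Y_i=r\},\qquad r\ge 1 .$$ Fix an integer $j\ge1$. Then, under the conditional laws $\mathbb P\bigl(\,\cdot\,\big|\,\sum_{i=1}^{N_n}Y_i=M_n\bigr)$,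 the random vectors $$\frac1{V_n}\bigl(\mathcal L_1^{(n)},\dots,\mathcal L_j^{(n)}\bigr)$$ satisfy a large deviation principle on $\mathbb R_+^j=[0,\infty)^j$ with speed $V_n$ and good rate function $J_{\rho,j}$ defined as follows. With $m_j:=\sum_{r=1}^jr\ell_r$ and the convention $0\log 0=0$, $$\begin{aligned}J_{\rho,j}(\ell_1,\dots,\ell_j)={}&\sum_{r=1}^j\ell_r\Bigl(\log\frac{\ell_r}{Q_r}-1\Bigr)+(\rho-m_j)\log\varphi_{j+1}(\rho-m_j)-\sum_{r=j+1}^\infty Q_r\,\varphi_{j+1}(\rho-m_j)^r\\&-\rho\log\varphi(\rho)+\sum_{r=1}^\infty Q_r\,\varphi(\rho)^r\end{aligned}$$ if $m_j\le\rho$, and $J_{\rho,j}(\ell_1,\dots,\ell_j)=\infty$ if $m_j>\rho$. Here the large deviation principle means that, with $P_n$ the conditional law of the vector, for every Borel set $B\subset\mathbb R_+^j$, $$-\inf_{\operatorname{int}B}J_{\rho,j}\le\liminf_{n\to\infty}\frac1{V_n}\log P_n(B)\le\limsup_{n\to\infty}\frac1{V_n}\log P_n(B)\le-\inf_{\overline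 B}J_{\rho,j},$$ and a good rate function is a lower semicontinuous function with values in $[0,\infty]$ whose sublevel sets $\{J_{\rho,j}\le a\}$, $a<\infty$, are compact. -/

import Mathlib

open MeasureTheory ProbabilityTheory Filter Topology
open scoped NNReal ENNReal

/-! ### Large deviation principles -/

/-- A good rate function: a lower semicontinuous function with values in `[0, ∞]` all of whose
(finite) sublevel sets are compact. -/
structure IsGoodRateFunction {X : Type*} [TopologicalSpace X] (I : X → EReal) : Prop where
  nonneg : ∀ x, 0 ≤ I x
  lowerSemicontinuous : LowerSemicontinuous I
  isCompact_sublevel : ∀ a : ℝ, IsCompact {x | I x ≤ (a : EReal)}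

/-- The sequence of measures `P n` satisfies the large deviation principle with speed `a n` and
rate function `I`: for every Borel set `B`,
`-inf_{int B} I ≤ liminf (1/a n) log P n (B) ≤ limsup (1/a n) log P n (B) ≤ -inf_{cl B} I`.
Here `log 0 = -∞` and the infimum over the empty set is `+∞`. -/
structure SatisfiesLDP {X : Type*} [TopologicalSpace X] [MeasurableSpace X]
    (P : ℕ → Measure X) (a : ℕ → ℝ) (I : X → EReal) : Prop where
  lower : ∀ B : Set X, MeasurableSet B →
    -(⨅ x ∈ interior B, I x) ≤
      liminf (fun n => (((a n)⁻¹ : ℝ) : EReal) * ENNReal.log (P n B)) atTop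
  upper : ∀ B : Set X, MeasurableSet B →
    limsup (fun n => (((a n)⁻¹ : ℝ) : EReal) * ENNReal.log (P n B)) atTop ≤
      -(⨅ x ∈ closure B, I x)

/-! ### The weights and the functions `F_j`, `φ_j`

The weights `Q_r` are indexed by `r ≥ 1`; the value `Q 0` is never used.
A sum over `r ≥ j` is written as a sum over `r : ℕ` of the terms of index `r + j`. -/

/-- `w = ∑_{r ≥ 1} Q_r`. -/
noncomputable def totalWeight (Q : ℕ → ℝ≥0) : ℝ≥0 := ∑' r : ℕ, Q (r + 1)

/-- `F_j(z) = ∑_{r ≥ j} r Q_r z^r`, with values in `[0, ∞]`. -/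
noncomputable def massSeries (Q : ℕ → ℝ≥0) (j : ℕ) (z : ℝ≥0∞) : ℝ≥0∞ :=
  ∑' r : ℕ, ((r + j : ℕ) : ℝ≥0∞) * (Q (r + j) : ℝ≥0∞) * z ^ (r + j)

/-- The critical density `ρ_{c,j} = F_j(φ_c)`. -/
noncomputable def criticalDensity (Q : ℕ → ℝ≥0) (φc : ℝ≥0∞) (j : ℕ) : ℝ≥0∞ :=
  massSeries Q j φc

/-- `φ_j(x)`: the unique `z ∈ [0, φ_c]` with `F_j(z) = min (x, ρ_{c,j})`.
Existence and uniqueness are proved in `existsUnique_fugacity`. -/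
noncomputable def fugacity (Q : ℕ → ℝ≥0) (φc : ℝ≥0∞) (j : ℕ) (x : ℝ≥0) : ℝ≥0 :=
  Classical.epsilon fun z : ℝ≥0 =>
    (z : ℝ≥0∞) ≤ φc ∧ massSeries Q j z = min (x : ℝ≥0∞) (criticalDensity Q φc j)

theorem massSeries_mono (Q : ℕ → ℝ≥0) (j : ℕ) : Monotone (massSeries Q j) := by
  intro a b h
  unfold massSeries
  gcongr

theorem lowerSemicontinuous_massSeries (Q : ℕ → ℝ≥0) (j : ℕ) :
    LowerSemicontinuous (massSeries Q j) := by
  unfold massSeries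
  refine lowerSemicontinuous_tsum fun r => Continuous.lowerSemicontinuous ?_
  refine (ENNReal.continuous_const_mul ?_).comp (ENNReal.continuous_pow _)
  exact ENNReal.mul_ne_top (ENNReal.natCast_ne_top _) ENNReal.coe_ne_top

theorem summable_mul_pow_of_eventually {Q : ℕ → ℝ≥0} {y z : ℝ≥0} (hy0 : 0 < y) (hzy' : z < y)
    (hev : ∀ᶠ r : ℕ in atTop, Q r * y ^ r ≤ 1) :
    Summable fun r : ℕ => ((r : ℝ≥0) * Q r * z ^ r) := by
  have hg : Summable fun r : ℕ => ((r : ℝ) ^ 1 * ((z / y : ℝ≥0) : ℝ) ^ r) := by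
    apply summable_pow_mul_geometric_of_norm_lt_one
    rw [Real.norm_of_nonneg (NNReal.coe_nonneg _)]
    exact_mod_cast (div_lt_one hy0).2 hzy'
  have hg' : Summable fun r : ℕ => ((r : ℝ≥0) * (z / y) ^ r) := by
    rw [← NNReal.summable_coe]
    simpa using hg
  rw [← NNReal.summable_coe]
  refine Summable.of_norm_bounded_eventually_nat (NNReal.summable_coe.2 hg') ?_
  filter_upwards [hev] with r hr
  rw [Real.norm_of_nonneg (NNReal.coe_nonneg _)]
  have : (r : ℝ≥0) * Q r * z ^ r ≤ r * (z / y) ^ r := by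
    have hzz : z ^ r = y ^ r * (z / y) ^ r := by
      rw [← mul_pow, mul_div_cancel₀ _ hy0.ne']
    calc (r : ℝ≥0) * Q r * z ^ r = r * ((Q r * y ^ r) * (z / y) ^ r) := by rw [hzz]; ring
      _ ≤ r * (1 * (z / y) ^ r) := by gcongr
      _ = _ := by rw [one_mul]
  exact_mod_cast this

theorem mul_pow_le_one_of_lt_rpow {q y : ℝ≥0} {r : ℕ} (h1 : 1 ≤ r) (hq : 0 < q)
    (hr : (y : ℝ≥0∞) < (q : ℝ≥0∞) ^ (-(1 : ℝ) / (r : ℝ))) : q * y ^ r ≤ 1 := by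
  have hr0 : (r : ℝ) ≠ 0 := by exact_mod_cast (by omega : r ≠ 0)
  rw [← ENNReal.coe_rpow_of_ne_zero hq.ne', ENNReal.coe_lt_coe] at hr
  have h2 : (q ^ (-(1 : ℝ) / (r : ℝ))) ^ r = q⁻¹ := by
    rw [← NNReal.rpow_natCast, ← NNReal.rpow_mul, div_mul_cancel₀ _ hr0, NNReal.rpow_neg_one]
  calc q * y ^ r ≤ q * (q ^ (-(1 : ℝ) / (r : ℝ))) ^ r := by gcongr
    _ = 1 := by rw [h2, mul_inv_cancel₀ hq.ne']

/-- Root test: `F_j` is finite on `[0, φ_c)`. -/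
theorem massSeries_ne_top {Q : ℕ → ℝ≥0} (hQ : ∀ r, 1 ≤ r → 0 < Q r) {φc : ℝ≥0∞}
    (hlim : Tendsto (fun r : ℕ => (Q r : ℝ≥0∞) ^ (-(1 : ℝ) / (r : ℝ))) atTop (𝓝 φc))
    (j : ℕ) {z : ℝ≥0} (hz : (z : ℝ≥0∞) < φc) : massSeries Q j z ≠ ⊤ := by
  obtain ⟨y, hzy, hy⟩ := ENNReal.lt_iff_exists_nnreal_btwn.1 hz
  have hzy' : z < y := by exact_mod_cast hzy
  have hy0 : 0 < y := lt_of_le_of_lt zero_le hzy'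
  have hev : ∀ᶠ r : ℕ in atTop, Q r * y ^ r ≤ 1 := by
    filter_upwards [(tendsto_order.1 hlim).1 _ hy, eventually_ge_atTop 1] with r hr h1
    exact mul_pow_le_one_of_lt_rpow h1 (hQ r h1) hr
  have hsum := summable_mul_pow_of_eventually hy0 hzy' hev
  have hsum' : Summable fun r : ℕ => ((r + j : ℕ) : ℝ≥0) * Q (r + j) * z ^ (r + j) :=
    (NNReal.summable_nat_add_iff (f := fun r : ℕ => (r : ℝ≥0) * Q r * z ^ r) j).2 hsum
  have hne := ENNReal.tsum_coe_ne_top_iff_summable.2 hsum'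
  simpa only [massSeries, ENNReal.coe_mul, ENNReal.coe_pow, ENNReal.coe_natCast] using hne

/-- Existence and uniqueness of the number `φ_j(x)`. -/
theorem existsUnique_fugacity {Q : ℕ → ℝ≥0} (hQ : ∀ r, 1 ≤ r → 0 < Q r) {φc : ℝ≥0∞}
    (hφc : 0 < φc)
    (hlim : Tendsto (fun r : ℕ => (Q r : ℝ≥0∞) ^ (-(1 : ℝ) / (r : ℝ))) atTop (𝓝 φc))
    {j : ℕ} (hj : 1 ≤ j) (x : ℝ≥0) :
    ∃! z : ℝ≥0, (z : ℝ≥0∞) ≤ φc ∧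
      massSeries Q j z = min (x : ℝ≥0∞) (criticalDensity Q φc j) := by
  have hstrict : ∀ a b : ℝ≥0, a < b → massSeries Q j a ≠ ⊤ →
      massSeries Q j a < massSeries Q j b := by
    intro a b hab ha
    unfold massSeries at ha ⊢
    refine ENNReal.tsum_lt_tsum (i := 0) ha (fun r => by gcongr) ?_
    have h1 : ((0 + j : ℕ) : ℝ≥0) * Q (0 + j) * a ^ (0 + j) <
        ((0 + j : ℕ) : ℝ≥0) * Q (0 + j) * b ^ (0 + j) := by
      have hjpos : (0 : ℝ≥0) < ((0 + j : ℕ) : ℝ≥0) := by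
        have : 0 < 0 + j := by omega
        exact_mod_cast this
      have hQj := hQ (0 + j) (by omega)
      have hp : a ^ (0 + j) < b ^ (0 + j) := pow_lt_pow_left₀ hab zero_le (by omega)
      gcongr
    exact_mod_cast h1
  have hex : ∃ z : ℝ≥0, (z : ℝ≥0∞) ≤ φc ∧
      massSeries Q j z = min (x : ℝ≥0∞) (criticalDensity Q φc j) := by
    unfold criticalDensity
    rcases le_or_gt (massSeries Q j φc) x with h | h
    · have hfin : φc ≠ ⊤ := by
        rintro rfl
        have htop : massSeries Q j ⊤ = ⊤ := by
          unfold massSeries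
          refine ENNReal.tsum_eq_top_of_eq_top ⟨0, ?_⟩
          rw [ENNReal.top_pow (by omega)]
          refine ENNReal.mul_top (mul_ne_zero ?_ ?_)
          · have : 0 + j ≠ 0 := by omega
            exact_mod_cast this
          · exact_mod_cast (hQ (0 + j) (by omega)).ne'
        rw [htop] at h
        exact absurd h (by simp)
      lift φc to ℝ≥0 using hfin
      exact ⟨φc, le_rfl, (min_eq_right h).symm⟩
    · obtain ⟨y, hyφ, hxy⟩ : ∃ y : ℝ≥0, (y : ℝ≥0∞) < φc ∧ (x : ℝ≥0∞) < massSeries Q j y := by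
        have hopen : ∀ᶠ u in 𝓝 φc, (x : ℝ≥0∞) < massSeries Q j u :=
          lowerSemicontinuous_massSeries Q j φc _ h
        obtain ⟨l, hl, hl'⟩ := exists_Ioc_subset_of_mem_nhds hopen ⟨0, hφc⟩
        obtain ⟨y, h1, h2⟩ := ENNReal.lt_iff_exists_nnreal_btwn.1 hl
        exact ⟨y, h2, hl' ⟨h1, h2.le⟩⟩
      have hfin := massSeries_ne_top hQ hlim j hyφ
      let f : ℕ → ℝ≥0 → ℝ≥0 := fun r u => ((r + j : ℕ) : ℝ≥0) * Q (r + j) * u ^ (r + j)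
      have hcoe : ∀ u : ℝ≥0, massSeries Q j u = ∑' r, ((f r u : ℝ≥0) : ℝ≥0∞) := by
        intro u
        simp [massSeries, f]
      have hsy : Summable fun r => f r y := by
        rw [hcoe] at hfin
        exact ENNReal.tsum_coe_ne_top_iff_summable.1 hfin
      have hle : ∀ u ≤ y, ∀ r, f r u ≤ f r y := by
        intro u hu r
        simp only [f]
        gcongr
      have hval : ∀ u ≤ y, massSeries Q j u = ((∑' r, f r u : ℝ≥0) : ℝ≥0∞) := by
        intro u hu
        rw [hcoe, ENNReal.coe_tsum (NNReal.summable_of_le (hle u hu) hsy)]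
      have hcont : ContinuousOn (fun u : ℝ≥0 => ∑' r, (f r u : ℝ)) (Set.Icc 0 y) := by
        refine continuousOn_tsum (u := fun r => (f r y : ℝ)) (fun r => ?_)
          (NNReal.summable_coe.2 hsy) (fun r u hu => ?_)
        · simp only [f]
          fun_prop
        · rw [Real.norm_of_nonneg (NNReal.coe_nonneg _)]
          exact_mod_cast hle u hu.2 r
      have hivt := intermediate_value_Icc zero_le hcont
      have hx : (x : ℝ) ∈ Set.Icc (∑' r, (f r 0 : ℝ)) (∑' r, (f r y : ℝ)) := by
        constructor
        · have : ∀ r, f r 0 = 0 := by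
            intro r
            have hrj : r + j ≠ 0 := by omega
            simp only [f, zero_pow hrj, mul_zero]
          simp [this]
        · rw [hval y le_rfl] at hxy
          rw [← NNReal.coe_tsum]
          exact_mod_cast hxy.le
      obtain ⟨z, hz, hzx⟩ := hivt hx
      refine ⟨z, (ENNReal.coe_le_coe.2 hz.2).trans hyφ.le, ?_⟩
      rw [min_eq_left h.le, hval z hz.2]
      simp only [← NNReal.coe_tsum] at hzx
      exact_mod_cast hzx
  obtain ⟨z, hz, hFz⟩ := hex
  have hne : min (x : ℝ≥0∞) (criticalDensity Q φc j) ≠ ⊤ :=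
    ne_top_of_le_ne_top ENNReal.coe_ne_top (min_le_left _ _)
  refine ⟨z, ⟨hz, hFz⟩, ?_⟩
  rintro y ⟨-, hFy⟩
  rcases lt_trichotomy y z with h | h | h
  · exact absurd (hFy.trans hFz.symm) (hstrict y z h (hFy ▸ hne)).ne
  · exact h
  · exact absurd (hFz.trans hFy.symm) (hstrict z y h (hFz ▸ hne)).ne

/-- The defining property of `φ_j(x)`. -/
theorem fugacity_spec {Q : ℕ → ℝ≥0} (hQ : ∀ r, 1 ≤ r → 0 < Q r) {φc : ℝ≥0∞} (hφc : 0 < φc)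
    (hlim : Tendsto (fun r : ℕ => (Q r : ℝ≥0∞) ^ (-(1 : ℝ) / (r : ℝ))) atTop (𝓝 φc))
    {j : ℕ} (hj : 1 ≤ j) (x : ℝ≥0) :
    (fugacity Q φc j x : ℝ≥0∞) ≤ φc ∧
      massSeries Q j (fugacity Q φc j x) = min (x : ℝ≥0∞) (criticalDensity Q φc j) :=
  Classical.epsilon_spec (existsUnique_fugacity hQ hφc hlim hj x).exists

/-! ### The rate function -/

/-- `∑_{r ≥ j} Q_r z^r`. -/
noncomputable def numberSeries (Q : ℕ → ℝ≥0) (j : ℕ) (z : ℝ) : ℝ :=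
  ∑' r : ℕ, (Q (r + j) : ℝ) * z ^ (r + j)

/-- `m_j = ∑_{r=1}^j r ℓ_r`; the coordinate `ℓ_r` is `ℓ (r - 1)`. -/
noncomputable def marginalMass {j : ℕ} (ℓ : Fin j → ℝ≥0) : ℝ≥0 :=
  ∑ r : Fin j, (((r : ℕ) + 1 : ℕ) : ℝ≥0) * ℓ r

/-- The rate function `J_{ρ,j}` on `ℝ_+^j`. -/
noncomputable def marginalRate (Q : ℕ → ℝ≥0) (φc : ℝ≥0∞) (ρ : ℝ≥0) (j : ℕ)
    (ℓ : Fin j → ℝ≥0) : EReal :=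
  if marginalMass ℓ ≤ ρ then
    (((∑ r : Fin j, (ℓ r : ℝ) * (Real.log ((ℓ r : ℝ) / (Q ((r : ℕ) + 1) : ℝ)) - 1))
      + ((ρ : ℝ) - (marginalMass ℓ : ℝ))
          * Real.log (fugacity Q φc (j + 1) (ρ - marginalMass ℓ) : ℝ)
      - numberSeries Q (j + 1) (fugacity Q φc (j + 1) (ρ - marginalMass ℓ) : ℝ)
      - (ρ : ℝ) * Real.log (fugacity Q φc 1 ρ : ℝ)
      + numberSeries Q 1 (fugacity Q φc 1 ρ : ℝ) : ℝ) : EReal)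
  else ⊤

/-! ### The compound Poisson process -/

/-- `ℒ_r = #{i ≤ N : Y_i = r}`, the number of marks equal to `r` among the first `N` marks. -/
def markCount {Ω : Type*} (Y : ℕ → Ω → ℕ) (N : Ω → ℕ) (r : ℕ) (ω : Ω) : ℕ :=
  ∑ i ∈ Finset.range (N ω), if Y i ω = r then 1 else 0

/-- `∑_{i ≤ N} Y_i`. -/
def markTotal {Ω : Type*} (Y : ℕ → Ω → ℕ) (N : Ω → ℕ) (ω : Ω) : ℕ :=
  ∑ i ∈ Finset.range (N ω), Y i ω

/-- The random vector `(ℒ_1, …, ℒ_j) / V` in `ℝ_+^j`. -/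
noncomputable def scaledMarginals {Ω : Type*} (Y : ℕ → Ω → ℕ) (N : Ω → ℕ) (V : ℝ≥0) (j : ℕ)
    (ω : Ω) : Fin j → ℝ≥0 :=
  fun r => (markCount Y N ((r : ℕ) + 1) ω : ℝ≥0) / V

/-!
The marks of each size `r` form independent Poisson variables of parameter `Q_r V`, so
the event that the marginals are near `V ℓ` while the total mass is `M ~ ρ V` has probability
`exp (-V (w + smallRate ℓ + largeRate (ρ - m_j)) + o(V))`. Here `smallRate` is the usual Poisson
rate of the marks of size at most `j`, and `largeRate x` is the rate at which the marks larger than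
`j` carry the mass `x V`. The total mass alone is the case `j = 0` of this estimate, and dividing by
it gives the conditional law and the rate function `marginalRate`.

The upper half (`exists_nhds_measure_le`) is the exponential Markov inequality: weighting a mark of
size `r ≤ j` by `u_r` and a mark of size `r > j` by `z ^ r` gives
`E ∏ weights = exp (V (∑_{r ≤ j} Q_r u_r + ∑_{r > j} Q_r z ^ r - w))`, and on the event in question
the product of the weights is determined by `ℓ` and `ρ` up to `exp (o(V))`. The choice
`u_r = ℓ_r / Q_r`, `z = φ_{j+1}(ρ - m_j)` is optimal; no counting is needed.

The lower half (`eventually_le_measure`) is the probability of a single configuration, which is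
explicit up to Stirling's formula. It has about `V ℓ_r` marks of size `r ≤ j`, about
`V Q_r z ^ r` marks of size `j < r ≤ R + 1` with the same `z`, and one further large mark. This mark
carries the condensate, the excess of `ρ - m_j` over the critical density, at the cost
`φ_c ^ (-size)` of its weight; it costs nothing when there is no excess. The marks of size one
absorb the mass beyond the cut-off and the rounding errors, so that the total mass is exactly `M`.

These local estimates give the full statement (`goodRate_and_ldp_of_local`), since the
marginals stay in the compact set `{m_j ≤ ρ + 1}`. The rate function is non-negative and lower
semicontinuous because the two estimates hold for probability measures; no property of the functions
`φ_j` beyond their definition is used for that.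
-/

/-! ### From local exponential estimates to a large deviation principle -/

lemma inv_mul_log_ofReal_exp {a : ℝ} (ha : 0 < a) (c : ℝ) :
    ((a⁻¹ : ℝ) : EReal) * ENNReal.log (ENNReal.ofReal (Real.exp (-(c * a)))) =
      ((-c : ℝ) : EReal) := by
  rw [ENNReal.log_ofReal_of_pos (Real.exp_pos _), Real.log_exp, ← EReal.coe_mul]
  congr 1
  field_simp

lemma inv_mul_log_mono {a : ℝ} (ha : 0 < a) {p q : ℝ≥0∞} (h : p ≤ q) :
    ((a⁻¹ : ℝ) : EReal) * ENNReal.log p ≤ ((a⁻¹ : ℝ) : EReal) * ENNReal.log q :=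
  mul_le_mul_of_nonneg_left (ENNReal.log_monotone h) (by exact_mod_cast (inv_pos.2 ha).le)

/-- Exponential upper bounds around each point of a compact set add up to one for the whole set:
only finitely many neighbourhoods are needed, and their number does not grow with `n`. -/
lemma eventually_measure_le_of_isCompact {X : Type*} [TopologicalSpace X] [MeasurableSpace X]
    {P : ℕ → Measure X} {a : ℕ → ℝ} {c : ℝ} {K : Set X} (hK : IsCompact K)
    (h : ∀ x ∈ K, ∃ U ∈ 𝓝 x, ∀ᶠ n in atTop, P n U ≤ ENNReal.ofReal (Real.exp (-(c * a n)))) :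
    ∃ C : ℕ, ∀ᶠ n in atTop, P n K ≤ C * ENNReal.ofReal (Real.exp (-(c * a n))) := by
  refine hK.induction_on
    (p := fun s => ∃ C : ℕ, ∀ᶠ n in atTop, P n s ≤ C * ENNReal.ofReal (Real.exp (-(c * a n))))
    ⟨0, by simp⟩ ?_ ?_ ?_
  · rintro s t hst ⟨C, hC⟩
    exact ⟨C, hC.mono fun n hn => (measure_mono hst).trans hn⟩
  · rintro s t ⟨C, hC⟩ ⟨D, hD⟩
    refine ⟨C + D, ?_⟩
    filter_upwards [hC, hD] with n h1 h2
    calc P n (s ∪ t) ≤ P n s + P n t := measure_union_le _ _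
      _ ≤ _ := by push_cast; rw [add_mul]; gcongr
  · intro x hx
    obtain ⟨U, hU, hev⟩ := h x hx
    exact ⟨U, mem_nhdsWithin_of_mem_nhds hU, 1, by simpa using hev⟩

/-- Local exponential estimates on sub-probability measures concentrated on a fixed compact set
yield the large deviation principle. That the rate function is non-negative and lower
semicontinuous is a consequence: comparing the lower estimate at `x` with the total mass `1` gives
`I x ≥ 0`, and comparing it with the upper estimate at nearby points gives semicontinuity. -/
theorem goodRate_and_ldp_of_local {X : Type*} [TopologicalSpace X] [MeasurableSpace X]
    {P : ℕ → Measure X} {a : ℕ → ℝ} {I : X → EReal} (ha : Tendsto a atTop atTop)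
    (hP : ∀ n, P n Set.univ ≤ 1)
    (hlow : ∀ x (c : ℝ), I x < c → ∀ U, IsOpen U → x ∈ U →
      ∀ᶠ n in atTop, ENNReal.ofReal (Real.exp (-(c * a n))) ≤ P n U)
    (hup : ∀ x (c : ℝ), (c : EReal) < I x → ∃ U, IsOpen U ∧ x ∈ U ∧
      ∀ᶠ n in atTop, P n U ≤ ENNReal.ofReal (Real.exp (-(c * a n))))
    {K K' : Set X} (hK : IsCompact K) (hPK : ∀ᶠ n in atTop, P n Kᶜ = 0)
    (hK' : IsCompact K') (hIK : ∀ x, x ∉ K' → I x = ⊤) :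
    IsGoodRateFunction I ∧ SatisfiesLDP P a I := by
  have hpos : ∀ᶠ n in atTop, 0 < a n := ha.eventually_gt_atTop 0
  have hexp : ∀ {c d : ℝ}, (∀ᶠ n in atTop,
      ENNReal.ofReal (Real.exp (-(c * a n))) ≤ ENNReal.ofReal (Real.exp (-(d * a n)))) →
      d ≤ c := by
    intro c d h
    obtain ⟨n, hn, hn'⟩ := (h.and hpos).exists
    rw [ENNReal.ofReal_le_ofReal_iff (Real.exp_pos _).le, Real.exp_le_exp, neg_le_neg_iff] at hn
    exact le_of_mul_le_mul_right hn hn'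
  have hnonneg : ∀ x, 0 ≤ I x := by
    intro x
    by_contra! hx
    obtain ⟨c, hxc, hc0⟩ := EReal.lt_iff_exists_real_btwn.1 hx
    have h1 := hlow x c hxc Set.univ isOpen_univ trivial
    have : (0 : ℝ) ≤ c := hexp (c := c) (d := 0)
      (h1.mono fun n hn => by simpa using hn.trans (hP n))
    exact absurd hc0 (not_lt.2 (by exact_mod_cast this))
  have hlsc : LowerSemicontinuous I := by
    intro x y hy
    obtain ⟨c, hyc, hcx⟩ := EReal.lt_iff_exists_real_btwn.1 hy
    obtain ⟨U, hU, hxU, hev⟩ := hup x c hcx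
    filter_upwards [hU.mem_nhds hxU] with x' hx'
    refine hyc.trans_le ?_
    by_contra! hlt
    obtain ⟨d, hd, hdc⟩ := EReal.lt_iff_exists_real_btwn.1 hlt
    have h1 := hlow x' d hd U hU hx'
    have : c ≤ d := hexp ((h1.and hev).mono fun n hn => hn.1.trans hn.2)
    exact absurd hdc (not_lt.2 (by exact_mod_cast this))
  refine ⟨⟨hnonneg, hlsc, fun b => ?_⟩, ⟨fun B _ => ?_, fun B _ => ?_⟩⟩
  · refine hK'.of_isClosed_subset (hlsc.isClosed_preimage b) fun x hx => ?_
    by_contra hxK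
    have : I x ≤ (b : EReal) := hx
    rw [hIK x hxK] at this
    exact absurd this (not_le.2 (EReal.coe_lt_top b))
  · rw [EReal.neg_le]
    refine le_iInf₂ fun x hx => ?_
    refine EReal.le_of_forall_lt_iff_le.1 fun c hc => ?_
    rw [EReal.neg_le, ← EReal.coe_neg]
    refine le_liminf_of_le (by isBoundedDefault) ?_
    filter_upwards [hlow x c hc _ isOpen_interior hx, hpos] with n hn hn'
    rw [← inv_mul_log_ofReal_exp hn' c]
    exact inv_mul_log_mono hn' (hn.trans (measure_mono interior_subset))
  · rw [EReal.le_neg]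
    refine EReal.ge_of_forall_gt_iff_ge.1 fun c hc => ?_
    obtain ⟨d, hcd, hd⟩ := EReal.lt_iff_exists_real_btwn.1 hc
    have hcd' : c < d := by exact_mod_cast hcd
    obtain ⟨C, hC⟩ := eventually_measure_le_of_isCompact (P := P) (a := a) (c := d)
      (hK.inter_right (isClosed_closure (s := B))) fun x hx => by
        obtain ⟨U, hU, hxU, hev⟩ := hup x d (hd.trans_le (iInf₂_le x hx.2))
        exact ⟨U, hU.mem_nhds hxU, hev⟩
    -- the number `C` of neighbourhoods is absorbed by the gap between `c` and `d`
    have hCe : ∀ᶠ n in atTop, (C : ℝ) ≤ Real.exp ((d - c) * a n) :=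
      (Real.tendsto_exp_atTop.comp (ha.const_mul_atTop (sub_pos.2 hcd'))).eventually_ge_atTop _
    rw [EReal.le_neg, ← EReal.coe_neg]
    refine limsup_le_of_le (by isBoundedDefault) ?_
    filter_upwards [hC, hpos, hPK, hCe] with n hn hn' hnK hnC
    rw [← inv_mul_log_ofReal_exp hn' c]
    refine inv_mul_log_mono hn' ?_
    calc P n B ≤ P n (K ∩ closure B ∪ Kᶜ) := measure_mono fun x hx => by
          by_cases hxK : x ∈ K
          · exact Or.inl ⟨hxK, subset_closure hx⟩
          · exact Or.inr hxK
      _ ≤ P n (K ∩ closure B) + P n Kᶜ := measure_union_le _ _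
      _ ≤ C * ENNReal.ofReal (Real.exp (-(d * a n))) := by rw [hnK, add_zero]; exact hn
      _ = ENNReal.ofReal (C * Real.exp (-(d * a n))) := by
          rw [ENNReal.ofReal_mul (Nat.cast_nonneg _), ENNReal.ofReal_natCast]
      _ ≤ ENNReal.ofReal (Real.exp (-(c * a n))) := by
          refine ENNReal.ofReal_le_ofReal ?_
          calc (C : ℝ) * Real.exp (-(d * a n)) ≤
              Real.exp ((d - c) * a n) * Real.exp (-(d * a n)) := by gcongr
            _ = _ := by rw [← Real.exp_add]; congr 1; ring

/-! ### Counting sequences of a given type -/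

lemma log_factorial_le (n : ℕ) :
    Real.log n.factorial ≤ n * Real.log n - n + √n := by
  rcases Nat.eq_zero_or_pos n with rfl | hn
  · simp
  obtain ⟨m, rfl⟩ : ∃ m, n = m + 1 := ⟨n - 1, by omega⟩
  have h1 : Real.log (Stirling.stirlingSeq (m + 1)) ≤ Real.log (Stirling.stirlingSeq 1) :=
    Stirling.log_stirlingSeq'_antitone (Nat.zero_le m)
  rw [Stirling.log_stirlingSeq_formula, Stirling.log_stirlingSeq_formula] at h1
  have hpos : (0 : ℝ) < ((m + 1 : ℕ) : ℝ) := by positivity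
  rw [Real.log_mul two_ne_zero hpos.ne', Real.log_div hpos.ne' (Real.exp_pos 1).ne',
    Real.log_exp] at h1
  simp only [Nat.factorial_one, Nat.cast_one, Real.log_one, mul_one, one_div,
    Real.log_inv, Real.log_exp] at h1
  have h2 := Real.log_le_sub_one_of_pos (Real.sqrt_pos.2 hpos)
  rw [Real.log_sqrt hpos.le] at h2
  linarith

/-- The number of sequences in which each letter `a` occurs `d a` times is a multinomial
coefficient: compare coefficients in `(∑ X_a) ^ s`. -/
lemma card_sequences_eq_multinomial {σ : Type*} [Fintype σ] [DecidableEq σ] (d : σ →₀ ℕ) :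
    (Finset.univ.filter fun f : Fin (∑ a, d a) → σ =>
      ∑ i, Finsupp.single (f i) 1 = d).card = Nat.multinomial Finset.univ d := by
  have h := MvPolynomial.coeff_sum_X_pow_of_fintype (R := ℕ) d (∑ a, d a)
  rw [if_pos (by rw [Finsupp.sum_fintype _ _ (fun _ => rfl)]), Fintype.sum_pow,
    MvPolynomial.coeff_sum, Finsupp.multinomial_eq_of_support_subset (Finset.subset_univ _)] at h
  rw [Finset.card_filter, ← Nat.cast_id (Nat.multinomial _ _), ← h]
  refine Finset.sum_congr rfl fun f _ => ?_
  have : ∏ i, (MvPolynomial.X (f i) : MvPolynomial σ ℕ) =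
      MvPolynomial.monomial (∑ i, Finsupp.single (f i) 1) 1 := by
    rw [MvPolynomial.monomial_sum_one]
    rfl
  rw [this, MvPolynomial.coeff_monomial]

lemma sum_single_eq_iff {σ : Type*} [DecidableEq σ] {s : ℕ} (f : Fin s → σ) (d : σ →₀ ℕ) :
    ∑ i, Finsupp.single (f i) 1 = d ↔ ∀ a, (∑ i, if f i = a then 1 else 0) = d a := by
  rw [Finsupp.ext_iff]
  refine forall_congr' fun a => ?_
  rw [Finsupp.finsetSum_apply]
  simp only [Finsupp.single_apply]

/-! ### The compound Poisson process -/

/-- The number `N` of marks is a Poisson variable of parameter `w v`, and the marks `Y` are i.i.d.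
with law `Q_r / w`, independent of `N`. -/
structure IsCompoundPoisson (Q : ℕ → ℝ≥0) {Ω : Type*} [MeasurableSpace Ω] (μ : Measure Ω)
    (Y : ℕ → Ω → ℕ) (N : Ω → ℕ) (v : ℝ≥0) : Prop where
  measurable_mark : ∀ i, Measurable (Y i)
  indep_mark : iIndepFun Y μ
  mark_law : ∀ i r, 1 ≤ r → μ {ω | Y i ω = r} = ((Q r / totalWeight Q : ℝ≥0) : ℝ≥0∞)
  measurable_count : Measurable N
  count_law : μ.map N = poissonMeasure (totalWeight Q * v)
  indep_count : IndepFun N (fun ω i => Y i ω) μ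

section CompoundPoisson

variable {Q : ℕ → ℝ≥0} {Ω : Type*} [MeasurableSpace Ω] {μ : Measure Ω}
  {Y : ℕ → Ω → ℕ} {N : Ω → ℕ} {v : ℝ≥0}

lemma measurable_sum_range_random {E : Type*} [MeasurableSpace E] [AddCommMonoid E]
    [MeasurableAdd₂ E] {X : ℕ → Ω → E} (hX : ∀ i, Measurable (X i)) (hN : Measurable N) :
    Measurable fun ω => ∑ i ∈ Finset.range (N ω), X i ω := by
  have h : Measurable fun p : ℕ × Ω => ∑ i ∈ Finset.range p.1, X i p.2 :=
    measurable_from_prod_countable_right fun n =>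
      Finset.measurable_sum (Finset.range n) fun i _ => hX i
  exact h.comp (hN.prodMk measurable_id)

lemma measurable_markTotal (hY : ∀ i, Measurable (Y i)) (hN : Measurable N) :
    Measurable (markTotal Y N) :=
  measurable_sum_range_random hY hN

lemma measurable_markCount (hY : ∀ i, Measurable (Y i)) (hN : Measurable N) (r : ℕ) :
    Measurable (markCount Y N r) :=
  measurable_sum_range_random
    (fun i => (Measurable.of_discrete (f := fun y : ℕ => if y = r then 1 else 0)).comp (hY i)) hN

lemma measurable_scaledMarginals (hY : ∀ i, Measurable (Y i)) (hN : Measurable N) (v : ℝ≥0)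
    (j : ℕ) : Measurable (scaledMarginals Y N v j) :=
  measurable_pi_lambda _ fun _ =>
    (Measurable.of_discrete (f := fun c : ℕ => (c : ℝ≥0) / v)).comp (measurable_markCount hY hN _)

lemma measure_sequence (hYind : iIndepFun Y μ)
    (hYlaw : ∀ i r, 1 ≤ r → μ {ω | Y i ω = r} = ((Q r / totalWeight Q : ℝ≥0) : ℝ≥0∞))
    (hNY : IndepFun N (fun ω i => Y i ω) μ) {s : ℕ} (f : Fin s → ℕ) (hf : ∀ i, 1 ≤ f i) :
    μ {ω | N ω = s ∧ ∀ i : Fin s, Y i ω = f i} =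
      μ {ω | N ω = s} * ((∏ i, (Q (f i) / totalWeight Q) : ℝ≥0) : ℝ≥0∞) := by
  have h0 : MeasurableSet {y : ℕ → ℕ | ∀ i : Fin s, y i = f i} := by
    rw [Set.ofPred_forall]
    exact MeasurableSet.iInter fun i =>
      measurableSet_eq_fun (measurable_pi_apply (i : ℕ)) measurable_const
  have h1 := hNY.measure_inter_preimage_eq_mul {s} {y : ℕ → ℕ | ∀ i : Fin s, y i = f i}
    (measurableSet_singleton _) h0
  have h2 := (hYind.precomp Fin.val_injective).meas_iInter (s := fun i : Fin s => {ω | Y i ω = f i})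
    (fun i => ⟨{f i}, measurableSet_singleton _, rfl⟩)
  have e1 : {ω | N ω = s ∧ ∀ i : Fin s, Y i ω = f i} =
      N ⁻¹' {s} ∩ (fun ω i => Y i ω) ⁻¹' {y : ℕ → ℕ | ∀ i : Fin s, y i = f i} := by
    ext; simp
  have e2 : (fun ω i => Y i ω) ⁻¹' {y : ℕ → ℕ | ∀ i : Fin s, y i = f i} =
      ⋂ i : Fin s, {ω | Y i ω = f i} := by
    ext; simp
  rw [e1, h1, e2, h2, ENNReal.ofNNReal_finsetProd]
  congr 1
  exact Finset.prod_congr rfl fun i _ => hYlaw i _ (hf i)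

/-- The numbers of marks of the various sizes are independent Poisson variables. Recorded is the
resulting lower bound for the probability of the configuration with `d a` marks of size `size a` and
no others; it is obtained by summing over the sequences of this type. -/
lemma le_measure_configuration (h : IsCompoundPoisson Q μ Y N v) (hw : 0 < totalWeight Q)
    {σ : Type*} [Fintype σ] [DecidableEq σ] (size : σ ↪ ℕ) (hsize : ∀ a, 1 ≤ size a)
    (d : σ → ℕ) :
    ENNReal.ofReal (Real.exp (-(totalWeight Q * v)) *
        ∏ a, (((Q (size a) : ℝ) * v) ^ d a / (d a).factorial)) ≤
      μ {ω | markTotal Y N ω = ∑ a, d a * size a ∧ ∀ a, markCount Y N (size a) ω = d a} := by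
  obtain ⟨hYm, hYind, hYlaw, hNm, hNlaw, hNY⟩ := h
  set e : σ →₀ ℕ := Finsupp.equivFunOnFinite.symm d
  set s := ∑ a, e a
  set T := Finset.univ.filter fun f : Fin s → σ => ∑ i, Finsupp.single (f i) 1 = e
  have hTmem : ∀ f ∈ T, ∀ a, (∑ i, if f i = a then 1 else 0) = d a := fun f hf =>
    (sum_single_eq_iff f e).1 (Finset.mem_filter.1 hf).2
  have hprod : ∀ f ∈ T, ∀ g : σ → ℝ≥0, ∏ i, g (f i) = ∏ a, g a ^ d a := by
    intro f hf g
    rw [← Finset.prod_fiberwise_of_maps_to (s := Finset.univ) (t := Finset.univ) (g := f)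
      (fun _ _ => Finset.mem_univ _)]
    refine Finset.prod_congr rfl fun a _ => ?_
    rw [Finset.prod_congr rfl (g := fun _ => g a) (fun i hi => by rw [(Finset.mem_filter.1 hi).2]),
      Finset.prod_const, ← hTmem f hf a, Finset.card_filter]
  have hms : ∀ f : Fin s → σ, MeasurableSet {ω | N ω = s ∧ ∀ i : Fin s, Y i ω = size (f i)} := by
    intro f
    rw [Set.ofPred_and, Set.ofPred_forall]
    exact (hNm (measurableSet_singleton s)).inter (MeasurableSet.iInter fun i : Fin s =>
      (hYm i) (measurableSet_singleton (size (f i))))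
  have hdisj : (T : Set (Fin s → σ)).PairwiseDisjoint
      fun f => {ω | N ω = s ∧ ∀ i : Fin s, Y i ω = size (f i)} := by
    intro f _ g _ hfg
    refine Set.disjoint_left.2 fun ω h1 h2 => hfg ?_
    funext i
    exact size.injective ((h1.2 i).symm.trans (h2.2 i))
  have hsub : (⋃ f ∈ T, {ω | N ω = s ∧ ∀ i : Fin s, Y i ω = size (f i)}) ⊆
      {ω | markTotal Y N ω = ∑ a, d a * size a ∧ ∀ a, markCount Y N (size a) ω = d a} := by
    intro ω hω
    obtain ⟨f, hf, hN, hYf⟩ := by simpa only [Set.mem_iUnion, exists_prop] using hω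
    refine ⟨?_, fun a => ?_⟩
    · rw [markTotal, hN, ← Fin.sum_univ_eq_sum_range (fun i => Y i ω)]
      simp only [hYf, ← hTmem f hf, Finset.sum_mul]
      rw [Finset.sum_comm]
      simp
    · rw [markCount, hN, ← Fin.sum_univ_eq_sum_range (fun i => if Y i ω = size a then 1 else 0),
        ← hTmem f hf a]
      simp only [hYf, size.injective.eq_iff]
  refine le_trans ?_ (measure_mono hsub)
  rw [measure_biUnion_finset hdisj (fun f _ => hms f)]
  have hPs : μ {ω | N ω = s} = ENNReal.ofReal
      (Real.exp (-(totalWeight Q * v : ℝ≥0)) * (totalWeight Q * v : ℝ≥0) ^ s / s.factorial) := by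
    rw [← poissonMeasure_singleton, ← hNlaw, Measure.map_apply hNm (measurableSet_singleton s)]
    rfl
  rw [Finset.sum_congr rfl (g := fun _ => μ {ω | N ω = s} *
    ((∏ a, (Q (size a) / totalWeight Q) ^ d a : ℝ≥0) : ℝ≥0∞))
    (fun f hf => by rw [measure_sequence hYind hYlaw hNY _ (fun i => hsize _),
      hprod f hf (fun a => Q (size a) / totalWeight Q)]),
    Finset.sum_const, nsmul_eq_mul, card_sequences_eq_multinomial, hPs,
    ← ENNReal.ofReal_coe_nnreal, ← ENNReal.ofReal_mul (by positivity),
    ← ENNReal.ofReal_natCast, ← ENNReal.ofReal_mul (by positivity)]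
  refine ENNReal.ofReal_le_ofReal (le_of_eq ?_)
  have hmul : (∏ a, ((d a).factorial : ℝ)) * (Nat.multinomial Finset.univ e : ℝ) = s.factorial := by
    exact_mod_cast Nat.multinomial_spec Finset.univ e
  have hfac : (0 : ℝ) < ∏ a, ((d a).factorial : ℝ) :=
    Finset.prod_pos fun a _ => by positivity
  have hw' : (0 : ℝ) < totalWeight Q := hw
  have hM : (Nat.multinomial Finset.univ e : ℝ) = s.factorial / ∏ a, ((d a).factorial : ℝ) := by
    rw [← hmul]; field_simp
  have hs' : s = ∑ a, d a := rfl
  push_cast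
  rw [hM, Finset.prod_div_distrib, hs']
  simp only [mul_pow, div_pow]
  rw [Finset.prod_mul_distrib, Finset.prod_div_distrib, Finset.prod_pow_eq_pow_sum,
    Finset.prod_pow_eq_pow_sum]
  field_simp

end CompoundPoisson

/-! ### Exponential moments of the compound Poisson process -/

/-- The exponent by which a mark of size `y` is tilted: the weight of the mark is multiplied by
`u_r` if `y = r ≤ j`, and by `z ^ y` if `y > j`. -/
noncomputable def tilt {j : ℕ} (u : Fin j → ℝ) (z : ℝ) (y : ℕ) : ℝ :=
  y * Real.log z + ∑ r : Fin j,
    if y = (r : ℕ) + 1 then Real.log (u r) - ((r : ℕ) + 1 : ℕ) * Real.log z else 0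

lemma sum_tilt_marks {Ω : Type*} {Y : ℕ → Ω → ℕ} {N : Ω → ℕ} {j : ℕ}
    (u : Fin j → ℝ) (z : ℝ) (ω : Ω) :
    ∑ i ∈ Finset.range (N ω), tilt u z (Y i ω) = markTotal Y N ω * Real.log z +
      ∑ r : Fin j, (markCount Y N ((r : ℕ) + 1) ω : ℝ) *
        (Real.log (u r) - ((r : ℕ) + 1 : ℕ) * Real.log z) := by
  simp only [tilt, markTotal, markCount, Finset.sum_add_distrib, Nat.cast_sum, Finset.sum_mul,
    Nat.cast_ite, ite_mul, Nat.cast_zero, Nat.cast_one, one_mul, zero_mul]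
  rw [Finset.sum_comm]

section CompoundPoisson

variable {Q : ℕ → ℝ≥0} {Ω : Type*} [MeasurableSpace Ω] {μ : Measure Ω}
  {Y : ℕ → Ω → ℕ} {N : Ω → ℕ} {v : ℝ≥0}

lemma tsum_measure_eq_one [IsProbabilityMeasure μ] {X : Ω → ℕ} (hX : Measurable X) :
    ∑' r, μ {ω | X ω = r} = 1 := by
  have := Measure.isProbabilityMeasure_map (μ := μ) hX.aemeasurable
  have h := lintegral_countable' (μ := μ.map X) fun _ => (1 : ℝ≥0∞)
  rw [lintegral_one, measure_univ] at h
  rw [h]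
  refine tsum_congr fun r => ?_
  rw [one_mul, Measure.map_apply hX (measurableSet_singleton r)]
  rfl

/-- The laws `Q_r / w`, `r ≥ 1`, have total mass one, so a mark is almost surely positive. -/
lemma measure_mark_eq_zero [IsProbabilityMeasure μ] (hsum : Summable fun r => Q (r + 1))
    (hw : 0 < totalWeight Q) {X : Ω → ℕ} (hX : Measurable X)
    (hlaw : ∀ r, 1 ≤ r → μ {ω | X ω = r} = ((Q r / totalWeight Q : ℝ≥0) : ℝ≥0∞)) :
    μ {ω | X ω = 0} = 0 := by
  have h := tsum_measure_eq_one (μ := μ) hX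
  have h1 : ∑' r, μ {ω | X ω = r + 1} = 1 := by
    rw [tsum_congr fun r => hlaw (r + 1) (by omega), ← ENNReal.coe_tsum (hsum.div_const _),
      tsum_div_const]
    change ((totalWeight Q / totalWeight Q : ℝ≥0) : ℝ≥0∞) = 1
    rw [div_self hw.ne', ENNReal.coe_one]
  rw [tsum_eq_zero_add' ENNReal.summable, h1] at h
  calc μ {ω | X ω = 0} = μ {ω | X ω = 0} + 1 - 1 := (ENNReal.add_sub_cancel_right
        ENNReal.one_ne_top).symm
    _ = 0 := by rw [h, tsub_self]

lemma lintegral_mark [IsProbabilityMeasure μ] (hsum : Summable fun r => Q (r + 1))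
    (hw : 0 < totalWeight Q) {X : Ω → ℕ} (hX : Measurable X)
    (hlaw : ∀ r, 1 ≤ r → μ {ω | X ω = r} = ((Q r / totalWeight Q : ℝ≥0) : ℝ≥0∞))
    {g : ℕ → ℝ} (hg : ∀ r, 0 ≤ g r) {A : ℝ}
    (hA : HasSum (fun r => (Q (r + 1) : ℝ) * g (r + 1)) A) :
    ∫⁻ ω, ENNReal.ofReal (g (X ω)) ∂μ = ENNReal.ofReal (A / totalWeight Q) := by
  rw [← lintegral_map (f := fun r => ENNReal.ofReal (g r)) .of_discrete hX, lintegral_countable',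
    tsum_eq_zero_add' ENNReal.summable]
  have h0 : (μ.map X) {0} = 0 := by
    rw [Measure.map_apply hX (measurableSet_singleton 0)]
    exact measure_mark_eq_zero hsum hw hX hlaw
  have hr : ∀ r, ENNReal.ofReal (g (r + 1)) * (μ.map X) {r + 1} =
      ENNReal.ofReal ((Q (r + 1) : ℝ) * g (r + 1) / totalWeight Q) := by
    intro r
    rw [Measure.map_apply hX (measurableSet_singleton _)]
    have : X ⁻¹' {r + 1} = {ω | X ω = r + 1} := rfl
    rw [this, hlaw (r + 1) (by omega), ← ENNReal.ofReal_coe_nnreal, ← ENNReal.ofReal_mul (hg _)]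
    congr 1
    push_cast
    ring
  rw [h0, mul_zero, zero_add, tsum_congr hr]
  have hA' := hA.div_const (totalWeight Q : ℝ)
  rw [← ENNReal.ofReal_tsum_of_nonneg (fun r => div_nonneg (mul_nonneg (NNReal.coe_nonneg _) (hg _))
    (NNReal.coe_nonneg _)) hA'.summable, hA'.tsum_eq]

/-- The exponential moments of the compound Poisson process. -/
lemma lintegral_exp_sum_marks [IsProbabilityMeasure μ] (h : IsCompoundPoisson Q μ Y N v)
    (hsum : Summable fun r => Q (r + 1))
    (hw : 0 < totalWeight Q) {θ : ℕ → ℝ} {A : ℝ}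
    (hA : HasSum (fun r => (Q (r + 1) : ℝ) * Real.exp (θ (r + 1))) A) :
    ∫⁻ ω, ENNReal.ofReal (Real.exp (∑ i ∈ Finset.range (N ω), θ (Y i ω))) ∂μ =
      ENNReal.ofReal (Real.exp (v * (A - totalWeight Q))) := by
  obtain ⟨hYm, hYind, hYlaw, hNm, hNlaw, hNY⟩ := h
  have hA0 : 0 ≤ A := hA.nonneg fun r => by positivity
  have hw' : (0 : ℝ) < totalWeight Q := hw
  set G : ℕ → ℕ → ℝ≥0∞ := fun s n => if n = s then 1 else 0 with hG
  set H : ℕ → (ℕ → ℕ) → ℝ≥0∞ := fun s y =>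
    ∏ i ∈ Finset.range s, ENNReal.ofReal (Real.exp (θ (y i))) with hH
  have hHm : ∀ s, Measurable (H s) := fun s =>
    Finset.measurable_prod _ fun i _ => (Measurable.of_discrete
      (f := fun r : ℕ => ENNReal.ofReal (Real.exp (θ r)))).comp (measurable_pi_apply i)
  have hGm : ∀ s, Measurable fun ω => G s (N ω) := fun s =>
    (Measurable.of_discrete (f := G s)).comp hNm
  have hYp : Measurable fun ω i => Y i ω := measurable_pi_lambda _ hYm
  -- the expectation is split according to the value `s` of `N`
  have hpt : ∀ ω, ENNReal.ofReal (Real.exp (∑ i ∈ Finset.range (N ω), θ (Y i ω))) =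
      ∑' s, G s (N ω) * H s (fun i => Y i ω) := by
    intro ω
    rw [tsum_eq_single (N ω) (fun s hs => by simp [hG, hs.symm])]
    simp only [hG, hH, if_true, one_mul]
    rw [Real.exp_sum, ENNReal.ofReal_prod_of_nonneg fun i _ => (Real.exp_pos _).le]
  have hint : ∀ s, ∫⁻ ω, G s (N ω) * H s (fun i => Y i ω) ∂μ =
      ENNReal.ofReal (Real.exp (-(totalWeight Q * v)) * ((A * v) ^ s / s.factorial)) := by
    intro s
    rw [lintegral_mul_eq_lintegral_mul_lintegral_of_indepFun'' (f := fun ω => G s (N ω))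
      (g := fun ω => H s (fun i => Y i ω)) (hGm s).aemeasurable
      ((hHm s).comp hYp).aemeasurable
      (hNY.comp (φ := G s) (ψ := H s) .of_discrete (hHm s))]
    have h1 : ∫⁻ ω, G s (N ω) ∂μ = ENNReal.ofReal
        (Real.exp (-(totalWeight Q * v : ℝ≥0)) * (totalWeight Q * v : ℝ≥0) ^ s / s.factorial) := by
      rw [← poissonMeasure_singleton, ← hNlaw, ← lintegral_map (f := G s) .of_discrete hNm]
      have : G s = Set.indicator {s} 1 := by
        ext n
        simp [hG, Set.indicator_apply]
      rw [this, lintegral_indicator_one (measurableSet_singleton s)]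
    have h2 : ∫⁻ ω, H s (fun i => Y i ω) ∂μ = ENNReal.ofReal (A / totalWeight Q) ^ s := by
      simp only [hH]
      rw [lintegral_prod_eq_prod_lintegral_of_indepFun (Finset.range s)
        (fun i ω => ENNReal.ofReal (Real.exp (θ (Y i ω))))
        (hYind.comp (fun _ r => ENNReal.ofReal (Real.exp (θ r))) fun _ => .of_discrete)
        (fun i => (Measurable.of_discrete
          (f := fun r : ℕ => ENNReal.ofReal (Real.exp (θ r)))).comp (hYm i)),
        Finset.prod_congr rfl (fun i _ => lintegral_mark hsum hw (hYm i) (hYlaw i)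
          (g := fun r => Real.exp (θ r)) (fun r => (Real.exp_pos _).le) hA),
        Finset.prod_const, Finset.card_range]
    rw [h1, h2, ← ENNReal.ofReal_pow (by positivity), ← ENNReal.ofReal_mul (by positivity)]
    congr 1
    push_cast
    simp only [mul_pow, div_pow]
    field_simp
  rw [lintegral_congr hpt, lintegral_tsum (f := fun s ω => G s (N ω) * H s fun i => Y i ω)
    fun s => ((hGm s).mul ((hHm s).comp hYp)).aemeasurable, tsum_congr hint]
  have hexp : HasSum (fun s : ℕ => Real.exp (-(totalWeight Q * v)) * ((A * v) ^ s / s.factorial))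
      (Real.exp (v * (A - totalWeight Q))) := by
    have := (NormedSpace.expSeries_div_hasSum_exp (A * v : ℝ)).mul_left
      (Real.exp (-(totalWeight Q * v)))
    rw [← Real.exp_eq_exp_ℝ, ← Real.exp_add] at this
    convert! this using 2
    ring
  rw [← ENNReal.ofReal_tsum_of_nonneg (fun s => by positivity) hexp.summable, hexp.tsum_eq]

lemma hasSum_exp_tilt {j : ℕ} {u : Fin j → ℝ} (hu : ∀ r, 0 < u r) {z : ℝ} (hz : 0 < z)
    (hs : Summable fun r => (Q (r + (j + 1)) : ℝ) * z ^ (r + (j + 1))) :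
    HasSum (fun r => (Q (r + 1) : ℝ) * Real.exp (tilt u z (r + 1)))
      (∑ r : Fin j, (Q ((r : ℕ) + 1) : ℝ) * u r + numberSeries Q (j + 1) z) := by
  have h1 : ∀ r : Fin j, Real.exp (tilt u z ((r : ℕ) + 1)) = u r := by
    intro r
    rw [tilt, Finset.sum_eq_single r (fun b _ hb => if_neg fun h => hb (Fin.ext (by omega)))
      (by simp), if_pos rfl]
    rw [add_sub_cancel, Real.exp_log (hu r)]
  have h2 : ∀ r, Real.exp (tilt u z (r + j + 1)) = z ^ (r + j + 1) := by
    intro r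
    rw [tilt, Finset.sum_eq_zero (fun b _ => if_neg fun h => by have := b.2; omega), add_zero,
      ← Real.log_pow, Real.exp_log (by positivity)]
  have h3 : HasSum (fun r => (Q (r + j + 1) : ℝ) * Real.exp (tilt u z (r + j + 1)))
      (numberSeries Q (j + 1) z) := by
    simp only [h2]
    exact hs.hasSum
  have h4 := (hasSum_nat_add_iff (f := fun r => (Q (r + 1) : ℝ) * Real.exp (tilt u z (r + 1)))
    j).1 h3
  rw [← Fin.sum_univ_eq_sum_range (fun r => (Q (r + 1) : ℝ) * Real.exp (tilt u z (r + 1)))] at h4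
  simp only [h1] at h4
  rwa [add_comm] at h4

/-- The exponential Markov inequality for the compound Poisson process. -/
lemma measure_le_of_tilt [IsProbabilityMeasure μ] (h : IsCompoundPoisson Q μ Y N v)
    (hsum : Summable fun r => Q (r + 1))
    (hw : 0 < totalWeight Q) {j : ℕ} {u : Fin j → ℝ} (hu : ∀ r, 0 < u r) {z : ℝ} (hz : 0 < z)
    (hs : Summable fun r => (Q (r + (j + 1)) : ℝ) * z ^ (r + (j + 1))) {S : Set Ω} {B : ℝ}
    (hB : ∀ ω ∈ S, B ≤ markTotal Y N ω * Real.log z +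
      ∑ r : Fin j, (markCount Y N ((r : ℕ) + 1) ω : ℝ) *
        (Real.log (u r) - ((r : ℕ) + 1 : ℕ) * Real.log z)) :
    μ S ≤ ENNReal.ofReal (Real.exp (v * (∑ r : Fin j, (Q ((r : ℕ) + 1) : ℝ) * u r +
      numberSeries Q (j + 1) z - totalWeight Q) - B)) := by
  have hint := lintegral_exp_sum_marks h hsum hw (hasSum_exp_tilt hu hz hs)
  have hsub : S ⊆ {ω | ENNReal.ofReal (Real.exp B) ≤
      ENNReal.ofReal (Real.exp (∑ i ∈ Finset.range (N ω), tilt u z (Y i ω)))} := fun ω hω => by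
    refine ENNReal.ofReal_le_ofReal (Real.exp_le_exp.2 ?_)
    rw [sum_tilt_marks]
    exact hB ω hω
  have hm : Measurable fun ω =>
      ENNReal.ofReal (Real.exp (∑ i ∈ Finset.range (N ω), tilt u z (Y i ω))) :=
    ENNReal.measurable_ofReal.comp (Real.measurable_exp.comp (measurable_sum_range_random
      (fun i => (Measurable.of_discrete (f := tilt u z)).comp (h.measurable_mark i))
      h.measurable_count))
  refine (measure_mono hsub).trans ?_
  refine (meas_ge_le_lintegral_div hm.aemeasurable
    (by simpa using Real.exp_pos B) ENNReal.ofReal_ne_top).trans ?_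
  rw [hint, ← ENNReal.ofReal_div_of_pos (Real.exp_pos B), ← Real.exp_sub]

end CompoundPoisson

/-! ### The two parts of the rate function -/

/-- The Poisson part `∑_{r ≤ j} ℓ_r (log (ℓ_r / Q_r) - 1)` of the rate. -/
noncomputable def smallRate (Q : ℕ → ℝ≥0) {j : ℕ} (ℓ : Fin j → ℝ≥0) : ℝ :=
  ∑ r : Fin j, (ℓ r : ℝ) * (Real.log ((ℓ r : ℝ) / (Q ((r : ℕ) + 1) : ℝ)) - 1)

/-- The rate `x log φ_{j+1}(x) - ∑_{r > j} Q_r φ_{j+1}(x)^r` at which the marks larger than `j`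
carry the mass `x`. -/
noncomputable def largeRate (Q : ℕ → ℝ≥0) (φc : ℝ≥0∞) (j : ℕ) (x : ℝ≥0) : ℝ :=
  (x : ℝ) * Real.log (fugacity Q φc (j + 1) x : ℝ)
    - numberSeries Q (j + 1) (fugacity Q φc (j + 1) x : ℝ)

lemma marginalRate_of_le (Q : ℕ → ℝ≥0) (φc : ℝ≥0∞) {ρ : ℝ≥0} {j : ℕ} {ℓ : Fin j → ℝ≥0}
    (h : marginalMass ℓ ≤ ρ) :
    marginalRate Q φc ρ j ℓ =
      ((smallRate Q ℓ + largeRate Q φc j (ρ - marginalMass ℓ) - largeRate Q φc 0 ρ : ℝ) :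
        EReal) := by
  rw [marginalRate, if_pos h]
  congr 1
  simp only [smallRate, largeRate, NNReal.coe_sub h, zero_add]
  ring

lemma summable_mass_of_ne_top {Q : ℕ → ℝ≥0} {j : ℕ} {z : ℝ≥0} (h : massSeries Q j z ≠ ⊤) :
    Summable fun r : ℕ => ((r + j : ℕ) : ℝ) * (Q (r + j) : ℝ) * (z : ℝ) ^ (r + j) := by
  have h1 : ∑' r : ℕ, ((((r + j : ℕ) : ℝ≥0) * Q (r + j) * z ^ (r + j) : ℝ≥0) : ℝ≥0∞) ≠ ⊤ := by
    simpa only [massSeries, ENNReal.coe_mul, ENNReal.coe_pow, ENNReal.coe_natCast] using h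
  simpa using NNReal.summable_coe.2 (ENNReal.tsum_coe_ne_top_iff_summable.1 h1)

lemma summable_number_of_ne_top {Q : ℕ → ℝ≥0} {j : ℕ} (hj : 1 ≤ j) {z : ℝ≥0}
    (h : massSeries Q j z ≠ ⊤) :
    Summable fun r : ℕ => (Q (r + j) : ℝ) * (z : ℝ) ^ (r + j) := by
  refine Summable.of_nonneg_of_le (fun r => by positivity) (fun r => ?_) (summable_mass_of_ne_top h)
  have h1 : (1 : ℝ) ≤ ((r + j : ℕ) : ℝ) := by exact_mod_cast (by omega : 1 ≤ r + j)
  have h2 : (0 : ℝ) ≤ (Q (r + j) : ℝ) * (z : ℝ) ^ (r + j) := by positivity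
  rw [mul_assoc]
  nlinarith

lemma summable_weights {Q : ℕ → ℝ≥0} (hQ : ∀ r, 1 ≤ r → 0 < Q r) {φc : ℝ≥0∞} (hφc : 1 < φc)
    (hlim : Tendsto (fun r : ℕ => (Q r : ℝ≥0∞) ^ (-(1 : ℝ) / (r : ℝ))) atTop (𝓝 φc))
    (j : ℕ) : Summable fun r => Q (r + (j + 1)) := by
  have h := massSeries_ne_top hQ hlim (j + 1) (z := 1) (by simpa using hφc)
  rw [← NNReal.summable_coe]
  simpa using summable_number_of_ne_top (by omega) h

lemma totalWeight_pos {Q : ℕ → ℝ≥0} (hQ : ∀ r, 1 ≤ r → 0 < Q r)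
    (hsum : Summable fun r => Q (r + 1)) : 0 < totalWeight Q := by
  have h : Q (0 + 1) ≤ ∑' r, Q (r + 1) := hsum.le_tsum 0 fun _ _ => zero_le
  exact (hQ _ le_rfl).trans_le h

section Fugacity

variable {Q : ℕ → ℝ≥0} {φc : ℝ≥0∞}

lemma fugacity_mass_ne_top (hQ : ∀ r, 1 ≤ r → 0 < Q r) (hφc : 0 < φc)
    (hlim : Tendsto (fun r : ℕ => (Q r : ℝ≥0∞) ^ (-(1 : ℝ) / (r : ℝ))) atTop (𝓝 φc))
    (j : ℕ) (x : ℝ≥0) : massSeries Q (j + 1) (fugacity Q φc (j + 1) x) ≠ ⊤ := by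
  rw [(fugacity_spec hQ hφc hlim (by omega) x).2]
  exact ne_top_of_le_ne_top ENNReal.coe_ne_top (min_le_left _ _)

lemma massSeries_zero {j : ℕ} : massSeries Q (j + 1) 0 = 0 := by
  simp [massSeries]

lemma fugacity_zero (hQ : ∀ r, 1 ≤ r → 0 < Q r) (hφc : 0 < φc)
    (hlim : Tendsto (fun r : ℕ => (Q r : ℝ≥0∞) ^ (-(1 : ℝ) / (r : ℝ))) atTop (𝓝 φc))
    (j : ℕ) : fugacity Q φc (j + 1) 0 = 0 :=
  (existsUnique_fugacity hQ hφc hlim (j := j + 1) (by omega) 0).unique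
    (fugacity_spec hQ hφc hlim (by omega) 0) (by simp [massSeries_zero])

lemma fugacity_pos (hQ : ∀ r, 1 ≤ r → 0 < Q r) (hφc : 0 < φc)
    (hlim : Tendsto (fun r : ℕ => (Q r : ℝ≥0∞) ^ (-(1 : ℝ) / (r : ℝ))) atTop (𝓝 φc))
    (j : ℕ) {x : ℝ≥0} (hx : 0 < x) : 0 < fugacity Q φc (j + 1) x := by
  rw [pos_iff_ne_zero]
  intro h
  have h1 := (fugacity_spec hQ hφc hlim (j := j + 1) (by omega) x).2
  rw [h, ENNReal.coe_zero, massSeries_zero] at h1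
  have h2 : 0 < criticalDensity Q φc (j + 1) := by
    refine lt_of_lt_of_le ?_ (ENNReal.le_tsum 0)
    have := hQ (0 + (j + 1)) (by omega)
    refine ENNReal.mul_pos (mul_ne_zero ?_ ?_) (pow_ne_zero _ hφc.ne')
    · exact_mod_cast (by omega : 0 + (j + 1) ≠ 0)
    · exact_mod_cast this.ne'
  exact absurd h1 (lt_min (by exact_mod_cast hx) h2).ne

/-- At `x = 0` the fugacity is `0`; its logarithm enters with the factor `x`. -/
lemma largeRate_zero (hQ : ∀ r, 1 ≤ r → 0 < Q r) (hφc : 0 < φc)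
    (hlim : Tendsto (fun r : ℕ => (Q r : ℝ≥0∞) ^ (-(1 : ℝ) / (r : ℝ))) atTop (𝓝 φc))
    (j : ℕ) : largeRate Q φc j 0 = 0 := by
  simp [largeRate, fugacity_zero hQ hφc hlim, numberSeries]

/-- The rate of the large marks is approached by the exponents of the Markov inequality. -/
lemma exists_fugacity_exponent (hQ : ∀ r, 1 ≤ r → 0 < Q r) (hφc : 1 < φc)
    (hlim : Tendsto (fun r : ℕ => (Q r : ℝ≥0∞) ^ (-(1 : ℝ) / (r : ℝ))) atTop (𝓝 φc))
    (j : ℕ) (x : ℝ≥0) {η : ℝ} (hη : 0 < η) :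
    ∃ z : ℝ, 0 < z ∧ Summable (fun r => (Q (r + (j + 1)) : ℝ) * z ^ (r + (j + 1))) ∧
      largeRate Q φc j x - η ≤ x * Real.log z - numberSeries Q (j + 1) z := by
  have hφ0 : 0 < φc := zero_lt_one.trans hφc
  rcases eq_or_lt_of_le (zero_le : 0 ≤ x) with rfl | hx
  · -- `φ_{j+1}(0) = 0` is not admissible as an exponent; a small `z > 0` takes its place
    have hs := NNReal.summable_coe.2 (summable_weights hQ hφc hlim j)
    set S : ℝ := ∑' r, (Q (r + (j + 1)) : ℝ) with hS
    have hS0 : 0 ≤ S := tsum_nonneg fun r => NNReal.coe_nonneg _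
    set z : ℝ := min 1 (η / (S + 1)) with hzdef
    have hz : 0 < z := lt_min one_pos (by positivity)
    have hz1 : z ≤ 1 := min_le_left _ _
    have hle : ∀ r, (Q (r + (j + 1)) : ℝ) * z ^ (r + (j + 1)) ≤ Q (r + (j + 1)) * z := by
      intro r
      have : z ^ (r + (j + 1)) ≤ z := pow_le_of_le_one hz.le hz1 (by omega)
      gcongr
    have hsz : Summable fun r => (Q (r + (j + 1)) : ℝ) * z ^ (r + (j + 1)) :=
      Summable.of_nonneg_of_le (fun r => by positivity) hle (hs.mul_right z)
    refine ⟨z, hz, hsz, ?_⟩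
    have h1 : numberSeries Q (j + 1) z ≤ S * z := by
      rw [hS, ← tsum_mul_right]
      exact hsz.tsum_le_tsum hle (hs.mul_right z)
    have h2 : S * z ≤ η := by
      calc S * z ≤ (S + 1) * (η / (S + 1)) :=
            mul_le_mul (by linarith) (min_le_right _ _) hz.le (by linarith)
        _ = η := by field_simp
    rw [largeRate_zero hQ hφ0 hlim]
    simp only [NNReal.coe_zero, zero_mul]
    linarith
  · refine ⟨fugacity Q φc (j + 1) x, by exact_mod_cast fugacity_pos hQ hφ0 hlim j hx,
      summable_number_of_ne_top (by omega) (fugacity_mass_ne_top hQ hφ0 hlim j x), ?_⟩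
    rw [largeRate]
    linarith

end Fugacity

/-- The rate of a Poisson variable is approached by the exponents of the Markov inequality. -/
lemma exists_poisson_exponent {q l η : ℝ} (hq : 0 < q) (hl : 0 ≤ l) (hη : 0 < η) :
    ∃ u : ℝ, 0 < u ∧ l * (Real.log (l / q) - 1) - η ≤ l * Real.log u - q * u := by
  rcases eq_or_lt_of_le hl with rfl | hl
  · -- the optimal `u = l / q` vanishes; a small `u > 0` takes its place
    refine ⟨η / q, by positivity, ?_⟩
    rw [mul_div_cancel₀ _ hq.ne']
    simp
  · refine ⟨l / q, by positivity, ?_⟩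
    rw [mul_div_cancel₀ _ hq.ne']
    linarith

/-! ### The local upper bound -/

section Upper

variable {Q : ℕ → ℝ≥0} {φc : ℝ≥0∞} {V : ℕ → ℝ≥0} {M : ℕ → ℕ} {ρ : ℝ≥0}
  {Ω : Type*} [MeasurableSpace Ω] {μ : Measure Ω} [IsProbabilityMeasure μ]
  {Y : ℕ → Ω → ℕ} {N : ℕ → Ω → ℕ}

/-- The Markov bound with the exponents `u`, `z`, near `ℓ`: the product of the weights depends
continuously on the scaled marginals and the scaled total mass. -/
lemma exists_nhds_measure_le_of_tilt (h : ∀ n, IsCompoundPoisson Q μ Y (N n) (V n))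
    (hVpos : ∀ n, 0 < V n) (hM : Tendsto (fun n => (M n : ℝ≥0) / V n) atTop (𝓝 ρ))
    (hsum : Summable fun r => Q (r + 1)) (hw : 0 < totalWeight Q)
    {j : ℕ} {u : Fin j → ℝ} (hu : ∀ r, 0 < u r) {z : ℝ} (hz : 0 < z)
    (hs : Summable fun r => (Q (r + (j + 1)) : ℝ) * z ^ (r + (j + 1)))
    (ℓ : Fin j → ℝ≥0) {c : ℝ}
    (hc : c < ∑ r : Fin j, ((ℓ r : ℝ) * Real.log (u r) - Q ((r : ℕ) + 1) * u r) +
      (((ρ : ℝ) - marginalMass ℓ) * Real.log z - numberSeries Q (j + 1) z)) :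
    ∃ U, IsOpen U ∧ ℓ ∈ U ∧ ∀ᶠ n in atTop,
      μ {ω | markTotal Y (N n) ω = M n ∧ scaledMarginals Y (N n) (V n) j ω ∈ U} ≤
        ENNReal.ofReal (Real.exp (-((c + totalWeight Q) * V n))) := by
  set A := ∑ r : Fin j, (Q ((r : ℕ) + 1) : ℝ) * u r + numberSeries Q (j + 1) z with hA
  set g : ℝ≥0 × (Fin j → ℝ≥0) → ℝ := fun p => p.1 * Real.log z +
    ∑ r : Fin j, (p.2 r : ℝ) * (Real.log (u r) - ((r : ℕ) + 1 : ℕ) * Real.log z) with hg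
  have hgc : Continuous g := by fun_prop
  -- `V g (M / V, λ)` is the logarithm of the product of the weights when the marginals are `V λ`
  have hlt : c + A < g (ρ, ℓ) := by
    have hm : (marginalMass ℓ : ℝ) = ∑ r : Fin j, (((r : ℕ) + 1 : ℕ) : ℝ) * ℓ r := by
      simp [marginalMass]
    have : ∑ r : Fin j, (ℓ r : ℝ) * (Real.log (u r) - ((r : ℕ) + 1 : ℕ) * Real.log z) =
        ∑ r : Fin j, (ℓ r : ℝ) * Real.log (u r) - marginalMass ℓ * Real.log z := by
      rw [hm, Finset.sum_mul, ← Finset.sum_sub_distrib]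
      exact Finset.sum_congr rfl fun r _ => by ring
    simp only [hg, this, hA]
    rw [Finset.sum_sub_distrib] at hc
    linarith
  have hev : ∀ᶠ p in 𝓝 ρ ×ˢ 𝓝 ℓ, c + A < g p := by
    rw [← nhds_prod_eq]
    exact hgc.continuousAt.eventually_const_lt hlt
  obtain ⟨pa, hpa, pb, hpb, hpp⟩ := eventually_prod_iff.1 hev
  obtain ⟨U, hU, hUo, hℓ⟩ := eventually_nhds_iff.1 hpb
  refine ⟨U, hUo, hℓ, ?_⟩
  filter_upwards [hM.eventually hpa] with n hn
  have hVn : (0 : ℝ) < V n := hVpos n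
  refine (measure_le_of_tilt (h n) hsum hw hu hz hs (B := V n * (c + A)) ?_).trans
    (le_of_eq ?_)
  · rintro ω ⟨hT, hω⟩
    have := (hpp hn (hU _ hω)).le
    rw [hT]
    calc (V n : ℝ) * (c + A) ≤ V n * g ((M n : ℝ≥0) / V n, scaledMarginals Y (N n) (V n) j ω) := by
          gcongr
      _ = _ := by
          simp only [hg, scaledMarginals, NNReal.coe_div, NNReal.coe_natCast]
          rw [mul_add, Finset.mul_sum]
          congr 1
          · field_simp
          · exact Finset.sum_congr rfl fun r _ => by field_simp
  · congr 2
    rw [hA]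
    ring

/-- Around each `ℓ` with `m_j ≤ ρ`, the marginals lie near `V ℓ` while the total mass is `M` with
probability at most `exp (-V (w + smallRate + largeRate))`, to exponential order. -/
lemma exists_nhds_measure_le (hQ : ∀ r, 1 ≤ r → 0 < Q r) (hφc : 1 < φc)
    (hlim : Tendsto (fun r : ℕ => (Q r : ℝ≥0∞) ^ (-(1 : ℝ) / (r : ℝ))) atTop (𝓝 φc))
    (h : ∀ n, IsCompoundPoisson Q μ Y (N n) (V n))
    (hVpos : ∀ n, 0 < V n) (hM : Tendsto (fun n => (M n : ℝ≥0) / V n) atTop (𝓝 ρ))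
    {j : ℕ} {ℓ : Fin j → ℝ≥0} (hℓ : marginalMass ℓ ≤ ρ) {c : ℝ}
    (hc : c < smallRate Q ℓ + largeRate Q φc j (ρ - marginalMass ℓ)) :
    ∃ U, IsOpen U ∧ ℓ ∈ U ∧ ∀ᶠ n in atTop,
      μ {ω | markTotal Y (N n) ω = M n ∧ scaledMarginals Y (N n) (V n) j ω ∈ U} ≤
        ENNReal.ofReal (Real.exp (-((c + totalWeight Q) * V n))) := by
  have hsum := summable_weights hQ hφc hlim 0
  set η : ℝ := (smallRate Q ℓ + largeRate Q φc j (ρ - marginalMass ℓ) - c) / (j + 2) with hηdef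
  have hη : 0 < η := div_pos (by linarith) (by positivity)
  have hη' : (j + 2) * η = smallRate Q ℓ + largeRate Q φc j (ρ - marginalMass ℓ) - c := by
    rw [hηdef]; field_simp
  obtain ⟨z, hz, hs, hzle⟩ := exists_fugacity_exponent hQ hφc hlim j (ρ - marginalMass ℓ) hη
  choose u hu hule using fun r : Fin j => exists_poisson_exponent (q := Q ((r : ℕ) + 1))
    (by exact_mod_cast hQ _ (by omega)) (ℓ r).coe_nonneg hη
  refine exists_nhds_measure_le_of_tilt h hVpos hM hsum (totalWeight_pos hQ hsum) hu hz hs ℓ ?_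
  rw [NNReal.coe_sub hℓ] at hzle
  have h1 : smallRate Q ℓ - j * η ≤
      ∑ r : Fin j, ((ℓ r : ℝ) * Real.log (u r) - Q ((r : ℕ) + 1) * u r) := by
    have := Finset.sum_le_sum fun (r : Fin j) (_ : r ∈ Finset.univ) => hule r
    rw [Finset.sum_sub_distrib] at this
    simpa [smallRate] using this
  nlinarith

end Upper

/-! ### The local lower bound -/

/-- Stirling's upper bound for the factorial, in the scaling `l / V → p`. -/
lemma exists_tendsto_exp_le_pow_div_factorial {V : ℕ → ℝ≥0} (hVpos : ∀ n, 0 < V n)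
    (hV : Tendsto V atTop atTop) {q : ℝ} (hq : 0 < q) {l : ℕ → ℕ} {p : ℝ≥0}
    (hl : Tendsto (fun n => (l n : ℝ≥0) / V n) atTop (𝓝 p)) :
    ∃ t : ℕ → ℝ, Tendsto t atTop (𝓝 (-((p : ℝ) * (Real.log (p / q) - 1)))) ∧
      ∀ n, Real.exp (V n * t n) ≤ (q * V n) ^ l n / (l n).factorial := by
  set x : ℕ → ℝ := fun n => (l n : ℝ) / V n with hx
  have hxl : Tendsto x atTop (𝓝 (p : ℝ)) := by
    simpa [hx] using (NNReal.tendsto_coe.2 hl)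
  have hVr : Tendsto (fun n => (V n : ℝ)) atTop atTop := NNReal.tendsto_coe_atTop.2 hV
  refine ⟨fun n => x n * Real.log q - x n * Real.log (x n) + x n - √(x n) / √(V n), ?_, ?_⟩
  · have h1 : Tendsto (fun n => √(x n) / √(V n)) atTop (𝓝 0) :=
      (hxl.sqrt).div_atTop (Real.tendsto_sqrt_atTop.comp hVr)
    have h2 : Tendsto (fun n => x n * Real.log (x n)) atTop (𝓝 (p * Real.log p)) :=
      (Real.continuous_mul_log.tendsto _).comp hxl
    have h3 := (((hxl.mul_const (Real.log q)).sub h2).add hxl).sub h1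
    convert! h3 using 2
    rcases eq_or_ne (p : ℝ) 0 with hp | hp
    · simp [hp]
    · rw [Real.log_div hp hq.ne']
      ring
  · intro n
    have hVn : (0 : ℝ) < V n := hVpos n
    have hfac : (0 : ℝ) < (l n).factorial := by positivity
    rw [← Real.le_log_iff_exp_le (by positivity), Real.log_div (by positivity) hfac.ne',
      Real.log_pow, Real.log_mul hq.ne' hVn.ne']
    have h1 := log_factorial_le (l n)
    have h2 : (V n : ℝ) * (√(x n) / √(V n)) = √(l n) := by
      rw [hx, Real.sqrt_div (Nat.cast_nonneg _), div_div, Real.mul_self_sqrt hVn.le]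
      field_simp
    have h3 : (V n : ℝ) * x n = l n := by
      simp only [hx]
      field_simp
    have h4 : (V n : ℝ) * (x n * Real.log (x n)) = l n * Real.log (l n) - l n * Real.log (V n) := by
      rw [← mul_assoc, h3]
      rcases Nat.eq_zero_or_pos (l n) with h0 | h0
      · simp [h0]
      · have : (l n : ℝ) ≠ 0 := by positivity
        rw [hx, Real.log_div this hVn.ne']
        ring
    calc (V n : ℝ) * (x n * Real.log q - x n * Real.log (x n) + x n - √(x n) / √(V n)) =
          (V n * x n) * Real.log q - V n * (x n * Real.log (x n)) + V n * x n
            - V n * (√(x n) / √(V n)) := by ring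
      _ = l n * Real.log q - (l n * Real.log (l n) - l n * Real.log (V n)) + l n - √(l n) := by
          rw [h2, h3, h4]
      _ ≤ _ := by linarith

/-- A single mark of size `K ~ δ V` costs `δ log φ_c`; a mark of bounded size costs nothing. -/
lemma exists_cluster {Q : ℕ → ℝ≥0} {φc : ℝ≥0∞} {V : ℕ → ℝ≥0} (hQ : ∀ r, 1 ≤ r → 0 < Q r)
    (hlim : Tendsto (fun r : ℕ => (Q r : ℝ≥0∞) ^ (-(1 : ℝ) / (r : ℝ))) atTop (𝓝 φc))
    (hV : Tendsto V atTop atTop) {δ z : ℝ≥0} (hz : 0 < z) (hδ : δ = 0 ∨ φc = z) (R : ℕ) :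
    ∃ K : ℕ → ℕ, (∀ n, R < K n) ∧ Tendsto (fun n => (K n : ℝ≥0) / V n) atTop (𝓝 δ) ∧
      Tendsto (fun n => Real.log (Q (K n)) / V n) atTop (𝓝 (-((δ : ℝ) * Real.log z))) := by
  have hVr : Tendsto (fun n => (V n : ℝ)) atTop atTop := NNReal.tendsto_coe_atTop.2 hV
  rcases eq_or_ne δ 0 with rfl | hδ0
  · refine ⟨fun _ => R + 1, fun _ => R.lt_succ_self, ?_, ?_⟩
    · rw [← NNReal.tendsto_coe]
      push_cast
      exact tendsto_const_nhds.div_atTop hVr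
    · rw [NNReal.coe_zero, zero_mul, neg_zero]
      exact tendsto_const_nhds.div_atTop hVr
  · have hφ := hδ.resolve_left hδ0
    subst hφ
    have hδpos : (0 : ℝ) < δ := by exact_mod_cast pos_iff_ne_zero.2 hδ0
    have hz' : (z : ℝ) ≠ 0 := by exact_mod_cast hz.ne'
    have hlog : Tendsto (fun r : ℕ => Real.log (Q r) / r) atTop (𝓝 (-Real.log z)) := by
      have h1 := (ENNReal.tendsto_toReal ENNReal.coe_ne_top).comp hlim
      have h2 := ((Real.continuousAt_log (x := z) hz').tendsto.comp h1).neg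
      refine h2.congr' ?_
      filter_upwards [eventually_ge_atTop 1] with r hr
      have hQr : (0 : ℝ) < Q r := hQ r hr
      simp only [Function.comp_apply, ← ENNReal.toReal_rpow, ENNReal.coe_toReal]
      rw [Real.log_rpow hQr]
      ring
    set K : ℕ → ℕ := fun n => max (R + 1) ⌊(δ : ℝ) * V n⌋₊ with hK
    have hfl : Tendsto (fun n => ⌊(δ : ℝ) * V n⌋₊) atTop atTop :=
      tendsto_nat_floor_atTop.comp (hVr.const_mul_atTop hδpos)
    have hKtop : Tendsto K atTop atTop :=
      tendsto_atTop_mono (fun n => le_max_right _ _) hfl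
    have hKV : Tendsto (fun n => (K n : ℝ) / V n) atTop (𝓝 δ) := by
      refine ((tendsto_nat_floor_mul_div_atTop hδpos.le).comp hVr).congr' ?_
      filter_upwards [hfl.eventually_ge_atTop (R + 1)] with n hn
      simp only [hK, Function.comp_apply, max_eq_right hn]
    refine ⟨K, fun n => lt_of_lt_of_le R.lt_succ_self (le_max_left _ _), ?_, ?_⟩
    · rw [← NNReal.tendsto_coe]
      simpa using hKV
    · have h := (hlog.comp hKtop).mul hKV
      have e : -Real.log z * (δ : ℝ) = -((δ : ℝ) * Real.log z) := by ring
      rw [e] at h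
      refine h.congr fun n => ?_
      have hKn : (K n : ℝ) ≠ 0 := by
        have : 0 < K n := lt_of_lt_of_le R.succ_pos (le_max_left _ _)
        positivity
      simp only [Function.comp_apply]
      field_simp

/-- The configuration with `p_r V` marks of each size `r + 1 ≤ R` and one further mark of size `K`.
The mark count of size `1` absorbs the rounding errors, so that the total mass is exactly `M`. -/
lemma exists_configuration {V : ℕ → ℝ≥0} {M : ℕ → ℕ} {ρ : ℝ≥0} (hVpos : ∀ n, 0 < V n)
    (hV : Tendsto V atTop atTop) (hM : Tendsto (fun n => (M n : ℝ≥0) / V n) atTop (𝓝 ρ))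
    {R : ℕ} {p : Fin (R + 1) → ℝ≥0} {δ : ℝ≥0} (hp0 : 0 < p 0)
    (hmass : marginalMass p + δ = ρ) {K : ℕ → ℕ}
    (hKV : Tendsto (fun n => (K n : ℝ≥0) / V n) atTop (𝓝 δ)) :
    ∃ l : ℕ → Fin (R + 1) → ℕ,
      (∀ r, Tendsto (fun n => (l n r : ℝ≥0) / V n) atTop (𝓝 (p r))) ∧
      ∀ᶠ n in atTop, K n + ∑ r, l n r * ((r : ℕ) + 1) = M n := by
  have hVr : Tendsto (fun n => (V n : ℝ)) atTop atTop := NNReal.tendsto_coe_atTop.2 hV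
  set t : ℕ → Fin R → ℕ := fun n r => ⌊(p r.succ : ℝ) * V n⌋₊ with ht
  -- the mass of all marks but those of size one
  set D : ℕ → ℕ := fun n => K n + ∑ r : Fin R, t n r * ((r : ℕ) + 2) with hD
  have ht' : ∀ r, Tendsto (fun n => (t n r : ℝ) / V n) atTop (𝓝 (p r.succ)) := fun r =>
    (tendsto_nat_floor_mul_div_atTop (p r.succ).coe_nonneg).comp hVr
  have hpm : (p 0 : ℝ) = ρ - (δ + ∑ r : Fin R, (p r.succ : ℝ) * ((r : ℕ) + 2)) := by
    rw [← hmass, marginalMass, Fin.sum_univ_succ]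
    push_cast
    simp only [Fin.val_zero, Nat.cast_zero, zero_add, one_mul, Fin.val_succ, Nat.cast_add,
      Nat.cast_one]
    have : ∑ r : Fin R, ((r : ℕ) + 1 + 1 : ℝ) * p r.succ =
        ∑ r : Fin R, (p r.succ : ℝ) * ((r : ℕ) + 2) :=
      Finset.sum_congr rfl fun r _ => by ring
    rw [this]
    ring
  have hdiff : Tendsto (fun n => ((M n : ℝ) - D n) / V n) atTop (𝓝 (p 0)) := by
    have hM' : Tendsto (fun n => (M n : ℝ) / V n) atTop (𝓝 ρ) := by
      simpa using NNReal.tendsto_coe.2 hM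
    have hK' : Tendsto (fun n => (K n : ℝ) / V n) atTop (𝓝 δ) := by
      simpa using NNReal.tendsto_coe.2 hKV
    have hsum := tendsto_finsetSum Finset.univ
      fun (r : Fin R) _ => (ht' r).mul_const (((r : ℕ) : ℝ) + 2)
    rw [hpm]
    refine (hM'.sub (hK'.add hsum)).congr fun n => ?_
    simp only [hD]
    push_cast
    rw [sub_div, add_div, Finset.sum_div]
    congr 2
    exact Finset.sum_congr rfl fun r _ => by ring
  have hle : ∀ᶠ n in atTop, D n ≤ M n := by
    filter_upwards [hdiff.eventually_const_lt (show (0 : ℝ) < p 0 by exact_mod_cast hp0)] with n hn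
    have hVn : (0 : ℝ) < V n := hVpos n
    have h1 := (div_pos_iff_of_pos_right hVn).1 hn
    have h2 : (D n : ℝ) < M n := by linarith
    exact_mod_cast h2.le
  refine ⟨fun n => Fin.cons (M n - D n) (t n), fun r => ?_, ?_⟩
  · rw [← NNReal.tendsto_coe]
    refine Fin.cases ?_ (fun r => ?_) r
    · refine hdiff.congr' ?_
      filter_upwards [hle] with n hn
      rw [Fin.cons_zero, NNReal.coe_div, NNReal.coe_natCast, Nat.cast_sub hn]
    · simpa using ht' r
  · filter_upwards [hle] with n hn
    rw [Fin.sum_univ_succ]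
    simp only [Fin.cons_zero, Fin.cons_succ, Fin.val_zero, zero_add, mul_one, Fin.val_succ]
    have : D n = K n + ∑ r : Fin R, t n r * ((r : ℕ) + 1 + 1) := rfl
    omega

section Lower

variable {Q : ℕ → ℝ≥0} {φc : ℝ≥0∞} {V : ℕ → ℝ≥0} {M : ℕ → ℕ} {ρ : ℝ≥0}
  {Ω : Type*} [MeasurableSpace Ω] {μ : Measure Ω}
  {Y : ℕ → Ω → ℕ} {N : ℕ → Ω → ℕ}

/-- A profile `p` of the mark sizes up to `R + 1`, completed by one mark of size `K`, gives a lower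
bound for the probability that the marginals lie near `V p` while the total mass is `M`. -/
lemma eventually_le_measure_of_profile (h : ∀ n, IsCompoundPoisson Q μ Y (N n) (V n))
    (hQ : ∀ r, 1 ≤ r → 0 < Q r) (hw : 0 < totalWeight Q) (hVpos : ∀ n, 0 < V n)
    (hV : Tendsto V atTop atTop) (hM : Tendsto (fun n => (M n : ℝ≥0) / V n) atTop (𝓝 ρ))
    {R : ℕ} {p : Fin (R + 1) → ℝ≥0} {δ : ℝ≥0} (hp0 : 0 < p 0)
    (hmass : marginalMass p + δ = ρ) {K : ℕ → ℕ} (hKR : ∀ n, R + 1 < K n)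
    (hKV : Tendsto (fun n => (K n : ℝ≥0) / V n) atTop (𝓝 δ)) {κ : ℝ}
    (hKQ : Tendsto (fun n => Real.log (Q (K n)) / V n) atTop (𝓝 (-κ)))
    {j : ℕ} (hj : j ≤ R + 1) {U : Set (Fin j → ℝ≥0)} (hU : IsOpen U)
    (hpU : (fun r => p (Fin.castLE hj r)) ∈ U) {c : ℝ} (hc : smallRate Q p + κ < c) :
    ∀ᶠ n in atTop, ENNReal.ofReal (Real.exp (-((c + totalWeight Q) * V n))) ≤
      μ {ω | markTotal Y (N n) ω = M n ∧ scaledMarginals Y (N n) (V n) j ω ∈ U} := by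
  have hVr : Tendsto (fun n => (V n : ℝ)) atTop atTop := NNReal.tendsto_coe_atTop.2 hV
  obtain ⟨l, hl, hlM⟩ := exists_configuration hVpos hV hM hp0 hmass hKV
  choose t ht hexp using fun r : Fin (R + 1) => exists_tendsto_exp_le_pow_div_factorial hVpos hV
    (q := Q ((r : ℕ) + 1)) (by exact_mod_cast hQ _ (by omega)) (hl r)
  have hlV : Tendsto (fun n => Real.log (V n) / V n) atTop (𝓝 0) :=
    Real.isLittleO_log_id_atTop.tendsto_div_nhds_zero.comp hVr
  have htot : Tendsto (fun n => Real.log (Q (K n)) / V n + Real.log (V n) / V n + ∑ r, t r n)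
      atTop (𝓝 (-(smallRate Q p + κ))) := by
    have h1 := (hKQ.add hlV).add (tendsto_finsetSum Finset.univ fun r _ => ht r)
    convert! h1 using 2
    rw [Finset.sum_neg_distrib, smallRate]
    ring
  have hUev : ∀ᶠ n in atTop, (fun r : Fin j => (l n (Fin.castLE hj r) : ℝ≥0) / V n) ∈ U :=
    (tendsto_pi_nhds.2 fun r => hl (Fin.castLE hj r)).eventually (hU.mem_nhds hpU)
  filter_upwards [htot.eventually_const_lt (neg_lt_neg hc), hlM, hUev] with n hn hMn hUn
  have hVn : (0 : ℝ) < V n := hVpos n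
  have hQK : (0 : ℝ) < Q (K n) := hQ _ (by have := hKR n; omega)
  -- the sizes of the marks: `none` stands for the single mark of size `K n`
  let size : Option (Fin (R + 1)) ↪ ℕ :=
    ⟨fun a => a.elim (K n) fun r => (r : ℕ) + 1, by
      have := hKR n
      rintro (_ | a) (_ | b) hab
      · rfl
      · have := b.2; simp only [Option.elim] at hab; omega
      · have := a.2; simp only [Option.elim] at hab; omega
      · simp only [Option.elim] at hab
        rw [Fin.ext (by omega : (a : ℕ) = b)]⟩
  have hsize : ∀ a, 1 ≤ size a := by
    rintro (_ | a)
    · exact (by omega : 1 ≤ R + 1).trans (hKR n).le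
    · exact Nat.succ_pos _
  have hle := le_measure_configuration (h n) hw size hsize fun a => a.elim 1 (l n)
  refine le_trans ?_ (hle.trans (measure_mono ?_))
  · refine ENNReal.ofReal_le_ofReal ?_
    rw [Fintype.prod_option]
    simp only [Option.elim, pow_one, Nat.factorial_one, Nat.cast_one, div_one, size,
      Function.Embedding.coeFn_mk]
    have hK : Real.exp (V n * (Real.log (Q (K n)) / V n + Real.log (V n) / V n)) =
        Q (K n) * V n := by
      rw [← add_div, mul_div_cancel₀ _ hVn.ne', Real.exp_add, Real.exp_log hQK, Real.exp_log hVn]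
    calc Real.exp (-((c + totalWeight Q) * V n))
        ≤ Real.exp (-(totalWeight Q * V n)) * Real.exp (V n *
          (Real.log (Q (K n)) / V n + Real.log (V n) / V n + ∑ r, t r n)) := by
          rw [← Real.exp_add, Real.exp_le_exp]
          nlinarith
      _ = Real.exp (-(totalWeight Q * V n)) * ((Q (K n) * V n) * ∏ r, Real.exp (V n * t r n)) := by
          rw [mul_add, Real.exp_add, hK, Finset.mul_sum, Real.exp_sum]
      _ ≤ _ := by
          gcongr with r
          exact hexp r n
  · rintro ω ⟨hT, hC⟩
    refine ⟨?_, ?_⟩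
    · rw [hT, Fintype.sum_option, ← hMn]
      simp only [Option.elim, one_mul]
      rfl
    · convert hUn using 2 with r
      have := hC (some (Fin.castLE hj r))
      simp only [size, Function.Embedding.coeFn_mk, Option.elim, Fin.val_castLE] at this
      rw [scaledMarginals, this]

end Lower

lemma continuous_mul_log_div_sub_one (q : ℝ≥0) :
    Continuous fun y : ℝ≥0 => (y : ℝ) * (Real.log ((y : ℝ) / q) - 1) := by
  rcases eq_or_ne (q : ℝ) 0 with hq | hq
  · simp only [hq, div_zero, Real.log_zero]
    fun_prop
  · have h : Continuous fun y : ℝ≥0 => q * (((y : ℝ) / q) * Real.log ((y : ℝ) / q)) - y :=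
      ((Real.continuous_mul_log.comp (NNReal.continuous_coe.div_const _)).const_mul _).sub
        NNReal.continuous_coe
    refine h.congr fun y => ?_
    field_simp

lemma continuous_smallRate (Q : ℕ → ℝ≥0) (j : ℕ) :
    Continuous (smallRate Q : (Fin j → ℝ≥0) → ℝ) :=
  continuous_finsetSum _ fun r _ =>
    (continuous_mul_log_div_sub_one (Q ((r : ℕ) + 1))).comp (continuous_apply r)

lemma continuous_marginalMass (j : ℕ) : Continuous (marginalMass : (Fin j → ℝ≥0) → ℝ≥0) := by
  unfold marginalMass
  fun_prop

/-- If no mass is left for the marks larger than `j`, a small part of each `ℓ_r` is moved to the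
marks of size one, so as to have room for rounding. -/
lemma exists_profile_of_marginalMass_eq (Q : ℕ → ℝ≥0) {ρ : ℝ≥0} (hρ : 0 < ρ) {R : ℕ}
    {ℓ : Fin (R + 1) → ℝ≥0} (hℓ : marginalMass ℓ = ρ) {U : Set (Fin (R + 1) → ℝ≥0)}
    (hU : IsOpen U) (hℓU : ℓ ∈ U) {c : ℝ} (hc : smallRate Q ℓ < c) :
    ∃ p ∈ U, 0 < p 0 ∧ marginalMass p = ρ ∧ smallRate Q p < c := by
  set p : ℝ≥0 → Fin (R + 1) → ℝ≥0 := fun ε r => (1 - ε) * ℓ r + if r = 0 then ε * ρ else 0 with hp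
  have hpc : Continuous p := by
    refine continuous_pi fun r => ?_
    simp only [hp]
    split_ifs <;> fun_prop
  have hp0 : p 0 = ℓ := by
    funext r
    simp [hp]
  have h1 : ∀ᶠ ε in 𝓝 (0 : ℝ≥0), p ε ∈ U :=
    hpc.continuousAt.eventually (hU.mem_nhds (by rwa [hp0]))
  have h2 : ∀ᶠ ε in 𝓝 (0 : ℝ≥0), smallRate Q (p ε) < c :=
    ((continuous_smallRate Q _).comp hpc).continuousAt.eventually_lt_const
      (by simpa only [Function.comp_apply, hp0] using hc)
  have h3 : ∀ᶠ ε in 𝓝 (0 : ℝ≥0), ε < 1 := gt_mem_nhds one_pos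
  obtain ⟨ε, ⟨⟨h1, h2⟩, h3⟩, hε⟩ :=
    (((h1.and h2).and h3).filter_mono nhdsWithin_le_nhds |>.and
      (self_mem_nhdsWithin : Set.Ioi (0 : ℝ≥0) ∈ 𝓝[>] 0)).exists
  have hε : 0 < ε := hε
  refine ⟨p ε, h1, ?_, ?_, h2⟩
  · simp only [hp, if_true]
    exact add_pos_of_nonneg_of_pos zero_le (mul_pos hε hρ)
  · simp only [marginalMass, hp, mul_add, mul_ite, mul_zero, Finset.sum_add_distrib,
      Finset.sum_ite_eq', Finset.mem_univ, if_true, Fin.val_zero, zero_add, Nat.cast_one, one_mul]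
    have : ∑ r : Fin (R + 1), (((r : ℕ) + 1 : ℕ) : ℝ≥0) * ((1 - ε) * ℓ r) = (1 - ε) * ρ := by
      rw [← hℓ, marginalMass, Finset.mul_sum]
      exact Finset.sum_congr rfl fun r _ => by ring
    rw [this, ← add_mul, tsub_add_cancel_of_le h3.le, one_mul]

section Profile

variable {Q : ℕ → ℝ≥0} {φc : ℝ≥0∞} {ρ : ℝ≥0}

/-- The mass `F_{j+1}(φ_{j+1}(x))` of the marks larger than `j` in the optimal profile is at most
`x`; if it is smaller, then `φ_{j+1}(x) = φ_c`. -/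
lemma exists_mass_fugacity (hQ : ∀ r, 1 ≤ r → 0 < Q r) (hφc : 0 < φc)
    (hlim : Tendsto (fun r : ℕ => (Q r : ℝ≥0∞) ^ (-(1 : ℝ) / (r : ℝ))) atTop (𝓝 φc))
    (j : ℕ) (x : ℝ≥0) :
    ∃ F δ : ℝ≥0, F + δ = x ∧ (δ = 0 ∨ φc = fugacity Q φc (j + 1) x) ∧
      HasSum (fun i : ℕ => ((i + (j + 1) : ℕ) : ℝ≥0) * Q (i + (j + 1)) *
        fugacity Q φc (j + 1) x ^ (i + (j + 1))) F := by
  have hspec := fugacity_spec hQ hφc hlim (j := j + 1) (by omega) x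
  set z := fugacity Q φc (j + 1) x with hz
  have hsum : Summable fun i : ℕ => ((i + (j + 1) : ℕ) : ℝ≥0) * Q (i + (j + 1)) *
      z ^ (i + (j + 1)) := by
    rw [← NNReal.summable_coe]
    simpa using summable_mass_of_ne_top (fugacity_mass_ne_top hQ hφc hlim j x)
  set F := ∑' i : ℕ, ((i + (j + 1) : ℕ) : ℝ≥0) * Q (i + (j + 1)) * z ^ (i + (j + 1)) with hF
  have hFm : (F : ℝ≥0∞) = min (x : ℝ≥0∞) (criticalDensity Q φc (j + 1)) := by
    rw [← hspec.2, hF, ENNReal.coe_tsum hsum]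
    simp [massSeries]
  have hFx : F ≤ x := by
    have : (F : ℝ≥0∞) ≤ x := hFm ▸ min_le_left _ _
    exact_mod_cast this
  refine ⟨F, x - F, add_tsub_cancel_of_le hFx, ?_, hsum.hasSum⟩
  rcases eq_or_lt_of_le hFx with h | h
  · left
    rw [h, tsub_self]
  · right
    have hcrit : criticalDensity Q φc (j + 1) < x := by
      by_contra! hle
      rw [min_eq_left hle] at hFm
      exact h.ne (by exact_mod_cast hFm)
    have hfin : φc ≠ ⊤ := by
      rintro rfl
      have htop : criticalDensity Q ⊤ (j + 1) = ⊤ := by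
        refine ENNReal.tsum_eq_top_of_eq_top ⟨0, ?_⟩
        rw [ENNReal.top_pow (by omega)]
        refine ENNReal.mul_top (mul_ne_zero ?_ ?_)
        · exact_mod_cast (by omega : 0 + (j + 1) ≠ 0)
        · exact_mod_cast (hQ (0 + (j + 1)) (by omega)).ne'
      rw [htop] at hcrit
      exact not_top_lt hcrit
    have huniq := (existsUnique_fugacity hQ hφc hlim (j := j + 1) (by omega) x).unique
      hspec (y₂ := φc.toNNReal) (by
        rw [ENNReal.coe_toNNReal hfin]
        exact ⟨le_rfl, (min_eq_right hcrit.le).symm⟩)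
    rw [huniq, ENNReal.coe_toNNReal hfin]

/-- If mass is left for the marks larger than `j`, it is distributed as `Q_r φ_{j+1}(x)^r`, cut
off at a large `r`. The mass beyond the cut-off is put on the marks of size one, and the excess `δ`
over the critical density is left to a single large mark. -/
lemma exists_profile_of_marginalMass_lt (hQ : ∀ r, 1 ≤ r → 0 < Q r) (hφc : 0 < φc)
    (hlim : Tendsto (fun r : ℕ => (Q r : ℝ≥0∞) ^ (-(1 : ℝ) / (r : ℝ))) atTop (𝓝 φc))
    {j : ℕ} {ℓ : Fin j → ℝ≥0} (hℓ : marginalMass ℓ < ρ) {U : Set (Fin j → ℝ≥0)}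
    (hU : IsOpen U) (hℓU : ℓ ∈ U) {c : ℝ}
    (hc : smallRate Q ℓ + largeRate Q φc j (ρ - marginalMass ℓ) < c) :
    ∃ (R : ℕ) (hj : j ≤ R + 1) (p : Fin (R + 1) → ℝ≥0) (δ z : ℝ≥0), 0 < p 0 ∧
      marginalMass p + δ = ρ ∧ 0 < z ∧ (δ = 0 ∨ φc = z) ∧ (fun r => p (Fin.castLE hj r)) ∈ U ∧
      smallRate Q p + δ * Real.log z < c := by
  have hx : 0 < ρ - marginalMass ℓ := tsub_pos_of_lt hℓ
  obtain ⟨F, δ, hFδ, hδ, hF⟩ := exists_mass_fugacity hQ hφc hlim j (ρ - marginalMass ℓ)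
  have hz : 0 < fugacity Q φc (j + 1) (ρ - marginalMass ℓ) := fugacity_pos hQ hφc hlim j hx
  have hGs := summable_number_of_ne_top (by omega)
    (fugacity_mass_ne_top hQ hφc hlim j (ρ - marginalMass ℓ))
  rw [largeRate] at hc
  set z := fugacity Q φc (j + 1) (ρ - marginalMass ℓ) with hzdef
  set a : ℕ → ℝ≥0 := fun i => ((i + (j + 1) : ℕ) : ℝ≥0) * Q (i + (j + 1)) * z ^ (i + (j + 1))
    with ha
  have hapos : ∀ i, 0 < a i := fun i => by
    have := hQ (i + (j + 1)) (by omega)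
    simp only [ha]
    positivity
  set τ : ℕ → ℝ≥0 := fun k => ∑' i, a (i + (k + 1)) with hτ
  have hτ0 : Tendsto τ atTop (𝓝 0) :=
    (NNReal.tendsto_sum_nat_add a).comp (tendsto_add_atTop_nat 1)
  have hτpos : ∀ k, 0 < τ k := fun k => by
    have h1 : Summable fun i => a (i + (k + 1)) :=
      (NNReal.summable_nat_add_iff (k + 1)).2 hF.summable
    have h2 : a (0 + (k + 1)) ≤ τ k := h1.le_tsum 0 fun _ _ => zero_le
    exact (hapos _).trans_le h2
  have hFτ : ∀ k, ∑ i ∈ Finset.range (k + 1), a i + τ k = F := fun k => by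
    have h1 := NNReal.sum_add_tsum_nat_add (k + 1) hF.summable
    rw [hF.tsum_eq] at h1
    exact h1.symm
  -- `b` is the optimal profile and `p k` its truncation with the tail `τ k` put on size one
  set b : ℕ → ℝ≥0 := fun r => if h : r < j then ℓ ⟨r, h⟩ else Q (r + 1) * z ^ (r + 1) with hb
  have hbsum : ∀ {E : Type} [AddCommMonoid E] (f : ℕ → ℝ≥0 → E) (k : ℕ),
      ∑ r : Fin (j + k + 1), f r (b r) = ∑ r : Fin j, f r (ℓ r) +
        ∑ i ∈ Finset.range (k + 1), f (i + j) (Q (i + (j + 1)) * z ^ (i + (j + 1))) := by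
    intro E _ f k
    rw [Fin.sum_univ_eq_sum_range (fun r => f r (b r)), add_assoc, Finset.sum_range_add,
      ← Fin.sum_univ_eq_sum_range (fun r => f r (b r))]
    congr 1
    · exact Finset.sum_congr rfl fun r _ => by simp [hb]
    · refine Finset.sum_congr rfl fun i _ => ?_
      simp only [hb, dif_neg (by omega : ¬ j + i < j)]
      rw [show j + i = i + j by omega, add_assoc]
  set p : ∀ k, Fin (j + k + 1) → ℝ≥0 := fun k r => b r + if r = 0 then τ k else 0 with hp
  have hmass : ∀ k, marginalMass (p k) + δ = ρ := by
    intro k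
    have h1 := hbsum (fun r y => ((r + 1 : ℕ) : ℝ≥0) * y) k
    have h2 : marginalMass (p k) = marginalMass ℓ + F := by
      simp only [marginalMass, hp, mul_add, Finset.sum_add_distrib, mul_ite, mul_zero,
        Finset.sum_ite_eq', Finset.mem_univ, if_true, Fin.val_zero, zero_add, Nat.cast_one, one_mul]
      rw [h1, add_assoc, ← hFτ k]
      congr 2
      exact Finset.sum_congr rfl fun i _ => by simp only [ha]; rw [add_assoc i j 1, mul_assoc]
    rw [h2, add_assoc, hFδ, add_tsub_cancel_of_le hℓ.le]
  -- the contribution of the size `r + 1` to the rate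
  set h0 : ℕ → ℝ≥0 → ℝ := fun r y => (y : ℝ) * (Real.log ((y : ℝ) / Q (r + 1)) - 1) with hh0
  have hrate : ∀ k, smallRate Q (p k) = smallRate Q ℓ +
      ∑ i ∈ Finset.range (k + 1), ((a i : ℝ) * Real.log z - Q (i + (j + 1)) * z ^ (i + (j + 1))) +
      (h0 0 (b 0 + τ k) - h0 0 (b 0)) := by
    intro k
    have h1 : smallRate Q (p k) = ∑ r : Fin (j + k + 1),
        (h0 r (b r) + if r = 0 then h0 0 (b 0 + τ k) - h0 0 (b 0) else 0) := by
      refine Finset.sum_congr rfl fun r _ => ?_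
      rcases eq_or_ne r 0 with rfl | hr
      · simp [hp, hh0]
      · simp [hp, hh0, hr]
    rw [h1, Finset.sum_add_distrib, Finset.sum_ite_eq' Finset.univ, if_pos (Finset.mem_univ _),
      hbsum h0 k]
    congr 2
    refine Finset.sum_congr rfl fun i _ => ?_
    have hQi : (Q (i + (j + 1)) : ℝ) ≠ 0 := by
      exact_mod_cast (hQ (i + (j + 1)) (by omega)).ne'
    simp only [hh0, ha, add_assoc i j 1]
    push_cast
    rw [mul_div_cancel_left₀ _ hQi, Real.log_pow]
    push_cast
    ring
  have hratelim : Tendsto (fun k => smallRate Q (p k)) atTop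
      (𝓝 (smallRate Q ℓ + (F * Real.log z - numberSeries Q (j + 1) z) + 0)) := by
    simp only [hrate]
    refine (tendsto_const_nhds.add ?_).add ?_
    · have h1 := ((NNReal.hasSum_coe.2 hF).mul_right (Real.log z)).sub hGs.hasSum
      exact h1.tendsto_sum_nat.comp (tendsto_add_atTop_nat 1)
    · have h1 : Continuous (h0 0) := continuous_mul_log_div_sub_one _
      have h2 : Tendsto (fun k => b 0 + τ k) atTop (𝓝 (b 0)) := by
        simpa using hτ0.const_add (b 0)
      have h3 := ((h1.tendsto _).comp h2).sub_const (h0 0 (b 0))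
      rwa [sub_self] at h3
  have hc' : smallRate Q ℓ + (F * Real.log z - numberSeries Q (j + 1) z) + 0 <
      c - δ * Real.log z := by
    rw [← hFδ] at hc
    push_cast at hc
    linarith
  have hplim : Tendsto (fun k => fun r : Fin j => p k (Fin.castLE (by omega) r)) atTop (𝓝 ℓ) := by
    refine tendsto_pi_nhds.2 fun r => ?_
    have hbr : b r = ℓ r := by simp [hb]
    rw [← hbr]
    simp only [hp, Fin.val_castLE]
    rcases eq_or_ne (r : ℕ) 0 with hr | hr
    · have : ∀ k, Fin.castLE (by omega : j ≤ j + k + 1) r = 0 := fun k => Fin.ext hr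
      simpa [this] using hτ0.const_add (b r)
    · have : ∀ k, Fin.castLE (by omega : j ≤ j + k + 1) r ≠ 0 := fun k h => hr (Fin.ext_iff.1 h)
      simp [this]
  obtain ⟨k, hk1, hk2⟩ := ((hratelim.eventually_lt_const hc').and
    (hplim.eventually (hU.mem_nhds hℓU))).exists
  refine ⟨j + k, by omega, p k, δ, z, ?_, hmass k, hz, hδ, hk2, by linarith⟩
  simp only [hp, if_true]
  exact add_pos_of_nonneg_of_pos zero_le (hτpos k)

end Profile

section Lower

variable {Q : ℕ → ℝ≥0} {φc : ℝ≥0∞} {V : ℕ → ℝ≥0} {M : ℕ → ℕ} {ρ : ℝ≥0}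
  {Ω : Type*} [MeasurableSpace Ω] {μ : Measure Ω}
  {Y : ℕ → Ω → ℕ} {N : ℕ → Ω → ℕ}

/-- Around each `ℓ` with `m_j ≤ ρ`, the marginals lie near `V ℓ` while the total mass is `M` with
probability at least `exp (-V (w + smallRate + largeRate))`, to exponential order. -/
lemma eventually_le_measure (hQ : ∀ r, 1 ≤ r → 0 < Q r) (hφc : 1 < φc)
    (hlim : Tendsto (fun r : ℕ => (Q r : ℝ≥0∞) ^ (-(1 : ℝ) / (r : ℝ))) atTop (𝓝 φc))
    (h : ∀ n, IsCompoundPoisson Q μ Y (N n) (V n)) (hVpos : ∀ n, 0 < V n)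
    (hV : Tendsto V atTop atTop) (hρ : 0 < ρ)
    (hM : Tendsto (fun n => (M n : ℝ≥0) / V n) atTop (𝓝 ρ))
    {j : ℕ} {ℓ : Fin j → ℝ≥0} (hℓ : marginalMass ℓ ≤ ρ) {U : Set (Fin j → ℝ≥0)}
    (hU : IsOpen U) (hℓU : ℓ ∈ U) {c : ℝ}
    (hc : smallRate Q ℓ + largeRate Q φc j (ρ - marginalMass ℓ) < c) :
    ∀ᶠ n in atTop, ENNReal.ofReal (Real.exp (-((c + totalWeight Q) * V n))) ≤
      μ {ω | markTotal Y (N n) ω = M n ∧ scaledMarginals Y (N n) (V n) j ω ∈ U} := by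
  have hφ0 : 0 < φc := zero_lt_one.trans hφc
  have hw := totalWeight_pos hQ (summable_weights hQ hφc hlim 0)
  obtain ⟨R, hj, p, δ, z, hp0, hmass, hz, hδ, hpU, hpc⟩ :
      ∃ (R : ℕ) (hj : j ≤ R + 1) (p : Fin (R + 1) → ℝ≥0) (δ z : ℝ≥0), 0 < p 0 ∧
        marginalMass p + δ = ρ ∧ 0 < z ∧ (δ = 0 ∨ φc = z) ∧
        (fun r => p (Fin.castLE hj r)) ∈ U ∧ smallRate Q p + δ * Real.log z < c := by
    rcases eq_or_lt_of_le hℓ with heq | hlt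
    · obtain _ | R := j
      · rw [← heq] at hρ
        simp [marginalMass] at hρ
      · rw [heq, tsub_self, largeRate_zero hQ hφ0 hlim, add_zero] at hc
        obtain ⟨p, hpU, hp0, hpm, hpc⟩ :=
          exists_profile_of_marginalMass_eq Q hρ heq hU hℓU hc
        exact ⟨R, le_rfl, p, 0, 1, hp0, by rw [hpm, add_zero], one_pos, Or.inl rfl, hpU,
          by simpa using hpc⟩
    · exact exists_profile_of_marginalMass_lt hQ hφ0 hlim hlt hU hℓU hc
  obtain ⟨K, hKR, hKV, hKQ⟩ := exists_cluster hQ hlim hV hz hδ (R + 1)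
  exact eventually_le_measure_of_profile h hQ hw hVpos hV hM hp0 hmass hKR hKV hKQ hj hU hpU hpc

end Lower

/-! ### Conditioning on the total mass -/

lemma isCompact_marginalMass_le (j : ℕ) (b : ℝ≥0) :
    IsCompact {ℓ : Fin j → ℝ≥0 | marginalMass ℓ ≤ b} := by
  refine (isCompact_Icc (a := (0 : Fin j → ℝ≥0)) (b := fun _ => b)).of_isClosed_subset
    (isClosed_le (continuous_marginalMass j) continuous_const) fun ℓ hℓ => ⟨fun _ => zero_le, ?_⟩
  intro r
  have h1 : (((r : ℕ) + 1 : ℕ) : ℝ≥0) * ℓ r ≤ marginalMass ℓ :=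
    Finset.single_le_sum (f := fun r : Fin j => (((r : ℕ) + 1 : ℕ) : ℝ≥0) * ℓ r)
      (fun _ _ => zero_le) (Finset.mem_univ r)
  have h2 : ℓ r ≤ (((r : ℕ) + 1 : ℕ) : ℝ≥0) * ℓ r :=
    le_mul_of_one_le_left zero_le (by exact_mod_cast Nat.succ_pos _)
  exact h2.trans (h1.trans hℓ)

lemma sum_mul_markCount_le_markTotal {Ω : Type*} (Y : ℕ → Ω → ℕ) (N : Ω → ℕ) (j : ℕ) (ω : Ω) :
    ∑ r : Fin j, ((r : ℕ) + 1) * markCount Y N ((r : ℕ) + 1) ω ≤ markTotal Y N ω := by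
  simp only [markCount, markTotal, Finset.mul_sum]
  rw [Finset.sum_comm]
  refine Finset.sum_le_sum fun i _ => ?_
  by_cases h : ∃ r : Fin j, Y i ω = (r : ℕ) + 1
  · obtain ⟨r, hr⟩ := h
    rw [Finset.sum_eq_single r (fun b _ hb => by
      rw [if_neg fun h => hb (Fin.ext (by omega)), mul_zero]) (by simp), if_pos hr, mul_one, hr]
  · rw [Finset.sum_eq_zero fun r _ => by rw [if_neg fun hr => h ⟨r, hr⟩, mul_zero]]
    exact Nat.zero_le _

lemma marginalMass_scaledMarginals_le {Ω : Type*} (Y : ℕ → Ω → ℕ) (N : Ω → ℕ) (v : ℝ≥0) (j : ℕ)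
    (ω : Ω) : marginalMass (scaledMarginals Y N v j ω) ≤ (markTotal Y N ω : ℝ≥0) / v := by
  have h : marginalMass (scaledMarginals Y N v j ω) =
      ((∑ r : Fin j, ((r : ℕ) + 1) * markCount Y N ((r : ℕ) + 1) ω : ℕ) : ℝ≥0) / v := by
    simp only [marginalMass, scaledMarginals]
    push_cast
    rw [Finset.sum_div]
    exact Finset.sum_congr rfl fun r _ => by rw [mul_div_assoc]
  rw [h]
  gcongr
  exact sum_mul_markCount_le_markTotal Y N j ω

section Conditional

variable {Q : ℕ → ℝ≥0} {φc : ℝ≥0∞} {V : ℕ → ℝ≥0} {M : ℕ → ℕ} {ρ : ℝ≥0}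
  {Ω : Type*} [MeasurableSpace Ω] {μ : Measure Ω} {Y : ℕ → Ω → ℕ} {N : ℕ → Ω → ℕ}

/-- The normalisation is the case of no marginals of the local upper bound. -/
lemma eventually_measure_markTotal_le [IsProbabilityMeasure μ] (hQ : ∀ r, 1 ≤ r → 0 < Q r)
    (hφc : 1 < φc)
    (hlim : Tendsto (fun r : ℕ => (Q r : ℝ≥0∞) ^ (-(1 : ℝ) / (r : ℝ))) atTop (𝓝 φc))
    (h : ∀ n, IsCompoundPoisson Q μ Y (N n) (V n)) (hVpos : ∀ n, 0 < V n)
    (hM : Tendsto (fun n => (M n : ℝ≥0) / V n) atTop (𝓝 ρ)) {c : ℝ}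
    (hc : c < largeRate Q φc 0 ρ) :
    ∀ᶠ n in atTop, μ {ω | markTotal Y (N n) ω = M n} ≤
      ENNReal.ofReal (Real.exp (-((c + totalWeight Q) * V n))) := by
  have h0 : marginalMass (default : Fin 0 → ℝ≥0) = 0 := by simp [marginalMass]
  obtain ⟨U, -, hU, hev⟩ := exists_nhds_measure_le hQ hφc hlim h hVpos hM (j := 0) (ℓ := default)
    (by rw [h0]; exact zero_le) (c := c) (by rw [h0, tsub_zero]; simpa [smallRate] using hc)
  filter_upwards [hev] with n hn
  refine (measure_mono fun ω hω => ?_).trans hn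
  refine ⟨hω, ?_⟩
  rwa [Subsingleton.elim (scaledMarginals Y (N n) (V n) 0 ω) default]

/-- The normalisation is the case of no marginals of the local lower bound. -/
lemma eventually_le_measure_markTotal (hQ : ∀ r, 1 ≤ r → 0 < Q r) (hφc : 1 < φc)
    (hlim : Tendsto (fun r : ℕ => (Q r : ℝ≥0∞) ^ (-(1 : ℝ) / (r : ℝ))) atTop (𝓝 φc))
    (h : ∀ n, IsCompoundPoisson Q μ Y (N n) (V n)) (hVpos : ∀ n, 0 < V n)
    (hV : Tendsto V atTop atTop) (hρ : 0 < ρ)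
    (hM : Tendsto (fun n => (M n : ℝ≥0) / V n) atTop (𝓝 ρ)) {c : ℝ}
    (hc : largeRate Q φc 0 ρ < c) :
    ∀ᶠ n in atTop, ENNReal.ofReal (Real.exp (-((c + totalWeight Q) * V n))) ≤
      μ {ω | markTotal Y (N n) ω = M n} := by
  have h0 : marginalMass (default : Fin 0 → ℝ≥0) = 0 := by simp [marginalMass]
  have hev := eventually_le_measure hQ hφc hlim h hVpos hV hρ hM (j := 0) (ℓ := default)
    (by rw [h0]; exact zero_le) isOpen_univ trivial (c := c)
    (by rw [h0, tsub_zero]; simpa [smallRate] using hc)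
  filter_upwards [hev] with n hn
  exact hn.trans (measure_mono fun ω hω => hω.1)

lemma map_cond_apply {v : ℝ≥0} {N : Ω → ℕ} (h : IsCompoundPoisson Q μ Y N v) (m j : ℕ)
    {S : Set (Fin j → ℝ≥0)} (hS : MeasurableSet S) :
    (μ[|{ω | markTotal Y N ω = m}]).map (scaledMarginals Y N v j) S =
      μ {ω | markTotal Y N ω = m ∧ scaledMarginals Y N v j ω ∈ S} /
        μ {ω | markTotal Y N ω = m} := by
  have hm := measurable_scaledMarginals h.measurable_mark h.measurable_count v j
  have hT : MeasurableSet {ω | markTotal Y N ω = m} :=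
    measurable_markTotal h.measurable_mark h.measurable_count (measurableSet_singleton m)
  rw [Measure.map_apply hm hS, cond_apply hT, ENNReal.div_eq_inv_mul]
  rfl

lemma map_cond_univ_le_one {v : ℝ≥0} {N : Ω → ℕ} (h : IsCompoundPoisson Q μ Y N v) (m j : ℕ) :
    (μ[|{ω | markTotal Y N ω = m}]).map (scaledMarginals Y N v j) Set.univ ≤ 1 := by
  rw [map_cond_apply h m j MeasurableSet.univ]
  exact (ENNReal.div_le_div_right (measure_mono fun ω hω => hω.1) _).trans ENNReal.div_self_le_one

/-- No mass beyond `ρ`: the marginals carry at most the total mass `M ~ ρ V`. -/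
lemma eventually_map_cond_eq_zero (h : ∀ n, IsCompoundPoisson Q μ Y (N n) (V n))
    (hM : Tendsto (fun n => (M n : ℝ≥0) / V n) atTop (𝓝 ρ)) {j : ℕ} {b : ℝ≥0} (hb : ρ < b) :
    ∀ᶠ n in atTop, (μ[|{ω | markTotal Y (N n) ω = M n}]).map (scaledMarginals Y (N n) (V n) j)
      {ℓ | b < marginalMass ℓ} = 0 := by
  filter_upwards [hM.eventually_lt_const hb] with n hn
  rw [map_cond_apply (h n) _ _
    (isOpen_lt continuous_const (continuous_marginalMass j)).measurableSet]
  have : {ω | markTotal Y (N n) ω = M n ∧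
      scaledMarginals Y (N n) (V n) j ω ∈ {ℓ | b < marginalMass ℓ}} = ∅ := by
    refine Set.eq_empty_of_forall_notMem ?_
    rintro ω ⟨hT, hω⟩
    have h1 := marginalMass_scaledMarginals_le Y (N n) (V n) j ω
    rw [hT] at h1
    exact absurd (h1.trans_lt hn) (not_lt.2 (le_of_lt hω))
  rw [this, measure_empty, ENNReal.zero_div]

lemma ofReal_exp_div_ofReal_exp (c d w v : ℝ) :
    ENNReal.ofReal (Real.exp (-((c + w) * v))) / ENNReal.ofReal (Real.exp (-((d + w) * v))) =
      ENNReal.ofReal (Real.exp (-((c - d) * v))) := by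
  rw [← ENNReal.ofReal_div_of_pos (Real.exp_pos _), ← Real.exp_sub]
  congr 2
  ring

end Conditional

theorem mainTheorem2
    -- the weights `Q_r`, `r ≥ 1`, and `φ_c = lim Q_r^{-1/r} ∈ (1, ∞]`
    (Q : ℕ → ℝ≥0) (hQ : ∀ r, 1 ≤ r → 0 < Q r)
    (φc : ℝ≥0∞) (hφc : 1 < φc)
    (hlim : Tendsto (fun r : ℕ => (Q r : ℝ≥0∞) ^ (-(1 : ℝ) / (r : ℝ))) atTop (𝓝 φc))
    -- the volumes and the masses
    (V : ℕ → ℝ≥0) (hVpos : ∀ n, 0 < V n) (hV : Tendsto V atTop atTop)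
    (M : ℕ → ℕ) (ρ : ℝ≥0) (hρ : 0 < ρ)
    (hM : Tendsto (fun n => (M n : ℝ≥0) / V n) atTop (𝓝 ρ))
    -- the i.i.d. marks and, independent of them, the Poisson variables of parameter `w V`
    {Ω : Type*} [MeasurableSpace Ω] (μ : Measure Ω) [IsProbabilityMeasure μ]
    (Y : ℕ → Ω → ℕ) (hYm : ∀ i, Measurable (Y i)) (hYind : iIndepFun Y μ)
    (hYlaw : ∀ i r, 1 ≤ r → μ {ω | Y i ω = r} = ((Q r / totalWeight Q : ℝ≥0) : ℝ≥0∞))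
    (N : ℕ → Ω → ℕ) (hNm : ∀ n, Measurable (N n))
    (hNlaw : ∀ n, μ.map (N n) = poissonMeasure (totalWeight Q * V n))
    (hNY : ∀ n, IndepFun (N n) (fun ω i => Y i ω) μ)
    (j : ℕ) (hj : 1 ≤ j) :
    IsGoodRateFunction (marginalRate Q φc ρ j) ∧
    SatisfiesLDP
      (fun n => (μ[|{ω | markTotal Y (N n) ω = M n}]).map (scaledMarginals Y (N n) (V n) j))
      (fun n => (V n : ℝ))
      (marginalRate Q φc ρ j) := by
  have h : ∀ n, IsCompoundPoisson Q μ Y (N n) (V n) := fun n =>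
    ⟨hYm, hYind, hYlaw, hNm n, hNlaw n, hNY n⟩
  have hVr : Tendsto (fun n => (V n : ℝ)) atTop atTop := NNReal.tendsto_coe_atTop.2 hV
  refine goodRate_and_ldp_of_local hVr (fun n => map_cond_univ_le_one (h n) _ _) ?_ ?_
    (isCompact_marginalMass_le j (ρ + 1)) ?_ (isCompact_marginalMass_le j ρ)
    (fun ℓ hℓ => if_neg hℓ)
  · intro ℓ c hc U hU hℓU
    have hℓ : marginalMass ℓ ≤ ρ := by
      by_contra hℓ
      rw [marginalRate, if_neg hℓ] at hc
      exact not_top_lt hc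
    rw [marginalRate_of_le Q φc hℓ, EReal.coe_lt_coe_iff] at hc
    -- the gap below `c` is shared between numerator and normalisation
    obtain ⟨d, hd1, hd2⟩ := exists_between
      (show smallRate Q ℓ + largeRate Q φc j (ρ - marginalMass ℓ) - c < largeRate Q φc 0 ρ by
        linarith)
    filter_upwards [eventually_measure_markTotal_le hQ hφc hlim h hVpos hM hd2,
      eventually_le_measure hQ hφc hlim h hVpos hV hρ hM hℓ hU hℓU (c := c + d) (by linarith)]
      with n h1 h2
    rw [map_cond_apply (h n) _ _ hU.measurableSet]
    refine le_trans (le_of_eq ?_) (ENNReal.div_le_div h2 h1)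
    rw [ofReal_exp_div_ofReal_exp, add_sub_cancel_right]
  · intro ℓ c hc
    rcases le_or_gt (marginalMass ℓ) ρ with hℓ | hℓ
    · rw [marginalRate_of_le Q φc hℓ, EReal.coe_lt_coe_iff] at hc
      obtain ⟨d, hd1, hd2⟩ := exists_between
        (show largeRate Q φc 0 ρ < smallRate Q ℓ + largeRate Q φc j (ρ - marginalMass ℓ) - c by
          linarith)
      obtain ⟨U, hU, hℓU, hev⟩ := exists_nhds_measure_le hQ hφc hlim h hVpos hM hℓ (c := c + d)
        (by linarith)
      refine ⟨U, hU, hℓU, ?_⟩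
      filter_upwards [hev, eventually_le_measure_markTotal hQ hφc hlim h hVpos hV hρ hM hd1]
        with n h1 h2
      rw [map_cond_apply (h n) _ _ hU.measurableSet]
      refine (ENNReal.div_le_div h1 h2).trans (le_of_eq ?_)
      rw [ofReal_exp_div_ofReal_exp, add_sub_cancel_right]
    · obtain ⟨b, hρb, hbℓ⟩ := exists_between hℓ
      refine ⟨{ℓ | b < marginalMass ℓ}, isOpen_lt continuous_const (continuous_marginalMass j),
        hbℓ, ?_⟩
      filter_upwards [eventually_map_cond_eq_zero h hM hρb] with n hn
      rw [hn]
      exact zero_le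
  · have hset : {ℓ : Fin j → ℝ≥0 | marginalMass ℓ ≤ ρ + 1}ᶜ = {ℓ | ρ + 1 < marginalMass ℓ} := by
      ext ℓ
      simp
    rw [hset]
    exact eventually_map_cond_eq_zero h hM (lt_add_one ρ)
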